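/- Let $J$ be the James space of all real sequences $x=(x(n))_{n\in\mathbb N}$ with $$\|x\|_J=\sup\Big\{\Big(\sum_{i=1}^{m}\Big|\sum_{k\in I_i}x(k)\Big|^2\Big)^{1/2} : I_1,\dots,I_m \text{ disjoint intervals of } \mathbb N\Big\}<\infty,$$ let $J^*$ be its dual Banach space, and let $B_J$, $B_{J^*}$ be the closed unit balls. For a nonempty (finite or infinite) interval $I$ of $\mathbb N$ let $I^*\in J^*$ be the functional $I^*(x)=\sum_{n\in I}x(n)$. Let $\operatorname{Ext}(B)$ denote the set of extreme points of $B$. **Theorem.** A functional $x^*\in J^*$ belongs to $\operatorname{Ext}(B_{J^*})$ if and only if there are an index set $F$, which is either $\mathbb N$ or a nonempty finite initial segment of $\mathbb N$, nonempty intervals $(I_i)_{i\in F}$ of $\mathbb N$ such that every element of $I_i$ is smaller than every element of $I_j$ whenever $i<j$ in $F$, and real numbers $\alpha_i\neq 0$ $(i\in F)$ such that $$x^*=\sum_{i\in F}\alpha_i I_i^*\quad\text{(convergence in the norm of } J^*),$$ and the following two properties hold: 1. the sequence $x=\sum_{i\in F}\alpha_i e_i$ (that is, $x(i)=\alpha_i$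 for $i\in F$ and $x(i)=0$ for $i\notin F$) lies in $J$ and $x\in\operatorname{Ext}(B_J)$; 2. $\bigcup_{i\in F}I_i$ is an interval of $\mathbb N$. -/

import Mathlib

open Filter Topology

noncomputable section

/-- A finite family of pairwise disjoint bounded intervals of `ℕ`. -/
def IntervalFamily : Type :=
  {P : Finset (Finset ℕ) //
    (∀ I ∈ P, (I : Set ℕ).OrdConnected) ∧ (P : Set (Finset ℕ)).Pairwise Disjoint}

/-- The value `(∑_{I ∈ P} |∑_{k ∈ I} x(k)|²)^{1/2}` of a family of disjoint intervals on a
sequence. -/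
def familyNorm (x : ℕ → ℝ) (P : IntervalFamily) : ℝ :=
  Real.sqrt (∑ I ∈ P.1, |∑ k ∈ I, x k| ^ 2)

/-- The family without intervals. -/
instance : Nonempty IntervalFamily := ⟨⟨∅, by simp, by simp⟩⟩

/-- The family consisting of a single bounded interval. -/
def singleFamily (I : Finset ℕ) (hI : (I : Set ℕ).OrdConnected) : IntervalFamily :=
  ⟨{I}, by simpa using hI, by simp⟩

theorem familyNorm_singleFamily (x : ℕ → ℝ) (I : Finset ℕ) (hI : (I : Set ℕ).OrdConnected) :
    familyNorm x (singleFamily I hI) = |∑ k ∈ I, x k| := by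
  simp [familyNorm, singleFamily, Real.sqrt_sq_eq_abs]

theorem familyNorm_nonneg (x : ℕ → ℝ) (P : IntervalFamily) : 0 ≤ familyNorm x P :=
  Real.sqrt_nonneg _

theorem familyNorm_zero (P : IntervalFamily) : familyNorm 0 P = 0 := by
  simp [familyNorm]

theorem familyNorm_smul (c : ℝ) (x : ℕ → ℝ) (P : IntervalFamily) :
    familyNorm (c • x) P = |c| * familyNorm x P := by
  have h : ∑ I ∈ P.1, |∑ k ∈ I, (c • x) k| ^ 2 = |c| ^ 2 * ∑ I ∈ P.1, |∑ k ∈ I, x k| ^ 2 := by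
    rw [Finset.mul_sum]
    refine Finset.sum_congr rfl fun I _ => ?_
    simp only [Pi.smul_apply, smul_eq_mul, ← Finset.mul_sum, abs_mul, mul_pow]
  rw [familyNorm, familyNorm, h, Real.sqrt_mul (by positivity), Real.sqrt_sq (abs_nonneg c)]

theorem familyNorm_eq_norm (x : ℕ → ℝ) (P : IntervalFamily) :
    familyNorm x P =
      ‖(WithLp.toLp 2 (fun I : P.1 => ∑ k ∈ I.1, x k) : EuclideanSpace ℝ P.1)‖ := by
  rw [EuclideanSpace.norm_eq, familyNorm]
  congr 1
  rw [← Finset.sum_coe_sort]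
  simp

theorem familyNorm_add_le (x y : ℕ → ℝ) (P : IntervalFamily) :
    familyNorm (x + y) P ≤ familyNorm x P + familyNorm y P := by
  simp only [familyNorm_eq_norm]
  refine le_trans (le_of_eq ?_) (norm_add_le _ _)
  congr 1
  ext I
  simp [Finset.sum_add_distrib]

/-- The linear space of all real sequences whose James norm is finite. -/
def jamesSubmodule : Submodule ℝ (ℕ → ℝ) where
  carrier := {x | BddAbove (Set.range (familyNorm x))}
  zero_mem' := ⟨0, by rintro _ ⟨P, rfl⟩; exact (familyNorm_zero P).le⟩
  add_mem' := by
    rintro x y ⟨C, hC⟩ ⟨D, hD⟩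
    refine ⟨C + D, ?_⟩
    rintro _ ⟨P, rfl⟩
    exact (familyNorm_add_le x y P).trans (add_le_add (hC ⟨P, rfl⟩) (hD ⟨P, rfl⟩))
  smul_mem' := by
    rintro c x ⟨C, hC⟩
    refine ⟨|c| * C, ?_⟩
    rintro _ ⟨P, rfl⟩
    rw [familyNorm_smul]
    exact mul_le_mul_of_nonneg_left (hC ⟨P, rfl⟩) (abs_nonneg c)

/-- The James space `J`. This is a type of its own, so that it does not inherit the topology of
pointwise convergence from `ℕ → ℝ`; its topology is the one of the norm defined below. -/
def JamesSpace : Type := jamesSubmodule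

namespace JamesSpace

instance : AddCommGroup JamesSpace := inferInstanceAs (AddCommGroup jamesSubmodule)

instance : Module ℝ JamesSpace := inferInstanceAs (Module ℝ jamesSubmodule)

/-- An element of `J` is used as a sequence `n ↦ x n`. -/
instance : CoeFun JamesSpace (fun _ => ℕ → ℝ) := ⟨fun x => x.1⟩

theorem bddAbove (x : JamesSpace) : BddAbove (Set.range (familyNorm x)) := x.2

theorem coe_add (x y : JamesSpace) : ((x + y : JamesSpace) : ℕ → ℝ) = x + y := rfl

theorem coe_smul (c : ℝ) (x : JamesSpace) : ((c • x : JamesSpace) : ℕ → ℝ) = c • (x : ℕ → ℝ) := rfl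

theorem coe_zero : ((0 : JamesSpace) : ℕ → ℝ) = 0 := rfl

/-- The James norm: the supremum of `(∑_i |∑_{k ∈ I_i} x(k)|²)^{1/2}` over all finite families of
disjoint bounded intervals; `NatInterval.sqrt_sum_le_norm` shows that unbounded intervals do not
change it. -/
instance : Norm JamesSpace := ⟨fun x => ⨆ P : IntervalFamily, familyNorm x P⟩

theorem norm_def (x : JamesSpace) : ‖x‖ = ⨆ P : IntervalFamily, familyNorm x P := rfl

theorem familyNorm_le_norm (x : JamesSpace) (P : IntervalFamily) : familyNorm x P ≤ ‖x‖ :=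
  le_ciSup x.bddAbove P

theorem abs_sum_le_norm (x : JamesSpace) (I : Finset ℕ) (hI : (I : Set ℕ).OrdConnected) :
    |∑ k ∈ I, x k| ≤ ‖x‖ := by
  rw [← familyNorm_singleFamily x I hI]
  exact x.familyNorm_le_norm _

theorem normCore : NormedSpace.Core ℝ JamesSpace where
  norm_nonneg x := Real.iSup_nonneg fun P => familyNorm_nonneg x P
  norm_smul c x := by
    simp only [norm_def, coe_smul, familyNorm_smul, Real.norm_eq_abs]
    rw [Real.mul_iSup_of_nonneg (abs_nonneg c)]
  norm_triangle x y := ciSup_le fun P => (familyNorm_add_le x y P).trans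
    (add_le_add (x.familyNorm_le_norm P) (y.familyNorm_le_norm P))
  norm_eq_zero_iff x := by
    constructor
    · intro h
      refine Subtype.ext (funext fun n => ?_)
      have h1 := x.abs_sum_le_norm {n} (by simpa using Set.ordConnected_singleton)
      rw [h, Finset.sum_singleton] at h1
      exact abs_nonpos_iff.mp h1
    · rintro rfl
      simp [norm_def, coe_zero, familyNorm_zero]

instance : NormedAddCommGroup JamesSpace := NormedAddCommGroup.ofCore normCore

instance : NormedSpace ℝ JamesSpace := NormedSpace.ofCore normCore

end JamesSpace

/-- A nonempty interval of `ℕ`, bounded or not. -/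
structure NatInterval where
  carrier : Set ℕ
  nonempty : carrier.Nonempty
  ordConnected : carrier.OrdConnected

namespace NatInterval

open Classical in
/-- The part of an interval in `{0, …, N - 1}`. -/
def trunc (I : NatInterval) (N : ℕ) : Finset ℕ := (Finset.range N).filter (· ∈ I.carrier)

theorem mem_trunc (I : NatInterval) (N n : ℕ) : n ∈ I.trunc N ↔ n < N ∧ n ∈ I.carrier := by
  simp [trunc]

theorem trunc_ordConnected (I : NatInterval) (N : ℕ) : (I.trunc N : Set ℕ).OrdConnected := by
  have h : (I.trunc N : Set ℕ) = Set.Iio N ∩ I.carrier := by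
    ext n
    simp [mem_trunc]
  rw [h]
  exact Set.ordConnected_Iio.inter I.ordConnected

/-- The part of `I` in `[M, N)` is a bounded interval. -/
theorem trunc_sdiff_ordConnected (I : NatInterval) (M N : ℕ) :
    ((I.trunc N \ I.trunc M : Finset ℕ) : Set ℕ).OrdConnected := by
  have h : ((I.trunc N \ I.trunc M : Finset ℕ) : Set ℕ) =
      (Set.Iio N ∩ Set.Ici M) ∩ I.carrier := by
    ext n
    simp only [Finset.coe_sdiff, Set.mem_sdiff, Finset.mem_coe, mem_trunc, Set.mem_inter_iff,
      Set.mem_Iio, Set.mem_Ici]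
    constructor
    · rintro ⟨⟨h1, h2⟩, h3⟩
      exact ⟨⟨h1, not_lt.mp fun h => h3 ⟨h, h2⟩⟩, h2⟩
    · rintro ⟨⟨h1, h2⟩, h3⟩
      exact ⟨⟨h1, h3⟩, fun h => absurd h.1 (not_lt.mpr h2)⟩
  rw [h]
  exact (Set.ordConnected_Iio.inter Set.ordConnected_Ici).inter I.ordConnected

theorem trunc_mono (I : NatInterval) {M N : ℕ} (h : M ≤ N) : I.trunc M ⊆ I.trunc N := by
  intro n hn
  rw [mem_trunc] at hn ⊢
  exact ⟨hn.1.trans_le h, hn.2⟩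

/-- The sum of an element of `J` over a bounded interval far out is small. -/
theorem exists_tail_small (x : JamesSpace) {ε : ℝ} (hε : 0 < ε) :
    ∃ M : ℕ, ∀ I : Finset ℕ, (I : Set ℕ).OrdConnected → (∀ n ∈ I, M ≤ n) →
      |∑ k ∈ I, x k| < ε := by
  classical
  by_cases hx : ‖x‖ < ε
  · exact ⟨0, fun I hI _ => (x.abs_sum_le_norm I hI).trans_lt hx⟩
  have hx0 : ε ≤ ‖x‖ := not_lt.mp hx
  have hlt : Real.sqrt (‖x‖ ^ 2 - ε ^ 2) < ‖x‖ := by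
    rw [Real.sqrt_lt' (hε.trans_le hx0)]
    nlinarith
  obtain ⟨P, hP⟩ := exists_lt_of_lt_ciSup hlt
  refine ⟨(P.1.biUnion id).sup Nat.succ, fun I hI hM => ?_⟩
  have hdis : ∀ L ∈ P.1, Disjoint I L := by
    intro L hL
    rw [Finset.disjoint_left]
    intro n hn hnL
    have h1 := hM n hn
    have h2 : Nat.succ n ≤ (P.1.biUnion id).sup Nat.succ :=
      Finset.le_sup (f := Nat.succ) (Finset.mem_biUnion.mpr ⟨L, hL, hnL⟩)
    omega
  by_cases hIe : I = ∅
  · simpa [hIe] using hε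
  have hIP : I ∉ P.1 := fun h => hIe (by simpa using hdis I h)
  let Q : IntervalFamily := ⟨insert I P.1, by
    intro L hL
    rcases Finset.mem_insert.mp hL with rfl | hL
    · exact hI
    · exact P.2.1 L hL, by
    rw [Finset.coe_insert]
    refine P.2.2.insert fun L hL _ => ⟨hdis L hL, (hdis L hL).symm⟩⟩
  have hQ := x.familyNorm_le_norm Q
  rw [familyNorm, Real.sqrt_le_left (norm_nonneg x), Finset.sum_insert hIP] at hQ
  rw [familyNorm] at hP
  have h3 := (Real.sqrt_lt_sqrt_iff_of_pos
    (lt_of_le_of_ne (by positivity) (fun h => by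
      rw [← h, Real.sqrt_zero] at hP
      exact absurd hP (not_lt.mpr (Real.sqrt_nonneg _))))).mp hP
  exact abs_lt_of_sq_lt_sq' (by rw [sq_abs] at *; linarith) hε.le |> fun h => by
    rcases abs_cases (∑ k ∈ I, x k) with h' | h' <;> linarith [h.1, h.2]

/-- The partial sums of `∑_{n ∈ I} x(n)` converge. -/
theorem exists_tendsto (I : NatInterval) (x : JamesSpace) :
    ∃ s : ℝ, Tendsto (fun N => ∑ n ∈ I.trunc N, x n) atTop (𝓝 s) := by
  refine cauchySeq_tendsto_of_complete (Metric.cauchySeq_iff'.mpr fun ε hε => ?_)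
  obtain ⟨M, hM⟩ := exists_tail_small x hε
  refine ⟨M, fun N hN => ?_⟩
  rw [Real.dist_eq, ← Finset.sum_sdiff (I.trunc_mono hN), add_sub_cancel_right]
  refine hM _ (I.trunc_sdiff_ordConnected M N) fun n hn => ?_
  simp only [Finset.mem_sdiff, mem_trunc] at hn
  by_contra h
  exact hn.2 ⟨not_le.mp h, hn.1.2⟩

/-- The sum `∑_{n ∈ I} x(n)`, as the limit of its partial sums. -/
def sum (I : NatInterval) (x : JamesSpace) : ℝ :=
  limUnder atTop (fun N => ∑ n ∈ I.trunc N, x n)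

theorem tendsto_sum (I : NatInterval) (x : JamesSpace) :
    Tendsto (fun N => ∑ n ∈ I.trunc N, x n) atTop (𝓝 (I.sum x)) :=
  tendsto_nhds_limUnder (I.exists_tendsto x)

/-- The functional `I^* ∈ J^*`, `I^*(x) = ∑_{n ∈ I} x(n)`. -/
def functional (I : NatInterval) : StrongDual ℝ JamesSpace :=
  LinearMap.mkContinuous
    { toFun := I.sum
      map_add' := fun x y => tendsto_nhds_unique (I.tendsto_sum (x + y)) (by
        simpa [JamesSpace.coe_add, Finset.sum_add_distrib] using
          (I.tendsto_sum x).add (I.tendsto_sum y))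
      map_smul' := fun c x => tendsto_nhds_unique (I.tendsto_sum (c • x)) (by
        simpa [JamesSpace.coe_smul, Finset.mul_sum] using (I.tendsto_sum x).const_mul c) }
    1 (fun x => by
      rw [one_mul]
      exact le_of_tendsto (I.tendsto_sum x).norm
        (Eventually.of_forall fun N => x.abs_sum_le_norm _ (I.trunc_ordConnected N)))

theorem functional_apply (I : NatInterval) (x : JamesSpace) : I.functional x = I.sum x := rfl

/-- Unbounded intervals do not increase the James norm. -/
theorem sqrt_sum_le_norm {ι : Type*} (s : Finset ι) (I : ι → NatInterval)
    (hI : (s : Set ι).Pairwise fun i j => Disjoint (I i).carrier (I j).carrier)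
    (x : JamesSpace) : Real.sqrt (∑ i ∈ s, |(I i).sum x| ^ 2) ≤ ‖x‖ := by
  classical
  have hlim : Tendsto (fun N => Real.sqrt (∑ i ∈ s, |∑ n ∈ (I i).trunc N, x n| ^ 2)) atTop
      (𝓝 (Real.sqrt (∑ i ∈ s, |(I i).sum x| ^ 2))) :=
    (Real.continuous_sqrt.tendsto _).comp
      (tendsto_finsetSum s fun i _ => ((I i).tendsto_sum x).abs.pow 2)
  refine le_of_tendsto hlim (Eventually.of_forall fun N => ?_)
  set t := s.filter fun i => ((I i).trunc N).Nonempty with ht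
  have hdis : ∀ i ∈ t, ∀ j ∈ t, i ≠ j → Disjoint ((I i).trunc N) ((I j).trunc N) := by
    intro i hi j hj hij
    rw [Finset.disjoint_left]
    intro n hn hn'
    exact Set.disjoint_left.mp (hI (Finset.mem_filter.mp hi).1 (Finset.mem_filter.mp hj).1 hij)
      ((mem_trunc _ _ _).mp hn).2 ((mem_trunc _ _ _).mp hn').2
  have hinj : Set.InjOn (fun i => (I i).trunc N) (t : Set ι) := by
    intro i hi j hj h
    by_contra hij
    have h1 := hdis i hi j hj hij
    have h2 : (I i).trunc N = (I j).trunc N := h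
    rw [← h2, disjoint_self] at h1
    exact (Finset.mem_filter.mp hi).2.ne_empty h1
  have hsum : ∑ i ∈ s, |∑ n ∈ (I i).trunc N, x n| ^ 2 =
      ∑ L ∈ t.image (fun i => (I i).trunc N), |∑ n ∈ L, x n| ^ 2 := by
    rw [Finset.sum_image hinj, ht, Finset.sum_filter]
    refine Finset.sum_congr rfl fun i _ => ?_
    split_ifs with h
    · rfl
    · simp [Finset.not_nonempty_iff_eq_empty.mp h]
  rw [hsum]
  refine x.familyNorm_le_norm ⟨t.image (fun i => (I i).trunc N), ?_, ?_⟩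
  · intro L hL
    obtain ⟨i, _, rfl⟩ := Finset.mem_image.mp hL
    exact (I i).trunc_ordConnected N
  · intro L hL L' hL' hne
    obtain ⟨i, hi, rfl⟩ := Finset.mem_image.mp (Finset.mem_coe.mp hL)
    obtain ⟨j, hj, rfl⟩ := Finset.mem_image.mp (Finset.mem_coe.mp hL')
    exact hdis i hi j hj fun h => hne (by rw [h])

end NatInterval

/-- The index sets of families of intervals: `ℕ` itself and its nonempty finite initial segments. -/
def IsIndexSet (F : Set ℕ) : Prop :=
  F = Set.univ ∨ ∃ k : ℕ, 1 ≤ k ∧ F = Set.Iio k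

/-- A family `(I_i)_{i ∈ F}` of intervals of `ℕ` in successive order: every element of `I_i` is
smaller than every element of `I_j` when `i < j`. In particular the intervals are disjoint. -/
def Successive {F : Set ℕ} (I : F → NatInterval) : Prop :=
  ∀ i j : F, i < j → ∀ m ∈ (I i).carrier, ∀ n ∈ (I j).carrier, m < n

end

/-! Both unit balls are compared with the one of ℓ². A point `x` of the unit ball of `J` is extreme
exactly when `∑ x(n)² = 1` (`hasSum_sq_of_mem_extremePoints`, `mem_extremePoints_of_hasSum_sq`). On
the dual side, Cauchy–Schwarz gives `‖∑ α_i I_i^*‖² ≤ ∑ α_i²` for disjoint intervals.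

Necessity. The functionals of norm at most one that are constant on successive blocks, with block
values forming a point of the ball of `J`, are a weak* compact set norming `J`. By Milman's theorem
this set contains every extreme point (`mem_stepDual_of_mem_extremePoints`). Once zero coefficients
and unused blocks are dropped, the values form a vector `x` with `1 = ‖x^*‖² ≤ ∑ x(i)² ≤ ‖x‖² ≤ 1`,
so `x` is extreme. Consecutive coefficients `c, d` then have opposite signs. If the two intervals
left a gap with functional `G`, attaching the gap to either of them would give `x^* + cG` and `x^* +
dG` in the ball, with `x^*` strictly between them.

Sufficiency. Let `z` carry the value `α_i` at one point of each `I_i`. Then `‖z‖ ≤ 1` and `x^*(z) =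
1`, so in `x^* = a g + b h` both `g` and `h` take the value one at `z`. A first-order expansion of
`‖z + t y‖` bounds `g(y)` and `h(y)` when `y` consists of the first `N` signs of `z`, and also when
`y` is perturbed at one point `p`; the error `‖high N z‖` tends to zero. Subtracting gives `g(e_p) =
x^*(e_p)` (`apply_single_eq`). If `p` lies in some `I_i`, it is taken as the chosen point there;
otherwise the absence of gaps puts `p` outside the hull of the support of `z`, where the alternating
signs can be continued by one more term. -/

namespace JamesSpace

/-! ### Norm estimates from interval sums; coordinates and unit vectors -/

/-- Indexed form of the defining inequality. Empty intervals may repeat in an indexed family, so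
they are discarded before passing to the set of intervals. -/
theorem sum_sq_le_norm_sq (x : JamesSpace) {ι : Type*} (s : Finset ι) (L : ι → Finset ℕ)
    (hL : ∀ i ∈ s, (L i : Set ℕ).OrdConnected) (hd : (s : Set ι).PairwiseDisjoint L) :
    ∑ i ∈ s, (∑ k ∈ L i, x k) ^ 2 ≤ ‖x‖ ^ 2 := by
  classical
  set t := s.filter fun i => (L i).Nonempty with ht
  have hinj : Set.InjOn L (t : Set ι) := by
    intro i hi j hj h
    by_contra hij
    have h1 : Disjoint (L i) (L j) :=
      hd (Finset.mem_filter.mp hi).1 (Finset.mem_filter.mp hj).1 hij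
    rw [← h, disjoint_self] at h1
    exact (Finset.mem_filter.mp hi).2.ne_empty h1
  have hsum : ∑ i ∈ s, (∑ k ∈ L i, x k) ^ 2 = ∑ K ∈ t.image L, |∑ k ∈ K, x k| ^ 2 := by
    rw [Finset.sum_image hinj, ht, Finset.sum_filter]
    refine Finset.sum_congr rfl fun i _ => ?_
    split_ifs with h
    · simp
    · simp [Finset.not_nonempty_iff_eq_empty.mp h]
  have h := x.familyNorm_le_norm ⟨t.image L, ?_, ?_⟩
  · rw [hsum]
    exact (Real.sqrt_le_left (norm_nonneg x)).mp h
  · intro K hK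
    obtain ⟨i, hi, rfl⟩ := Finset.mem_image.mp hK
    exact hL i (Finset.mem_filter.mp hi).1
  · intro K hK K' hK' hne
    obtain ⟨i, hi, rfl⟩ := Finset.mem_image.mp (Finset.mem_coe.mp hK)
    obtain ⟨j, hj, rfl⟩ := Finset.mem_image.mp (Finset.mem_coe.mp hK')
    exact hd (Finset.mem_filter.mp hi).1 (Finset.mem_filter.mp hj).1 fun h => hne (by rw [h])

theorem familyNorm_sq (x : ℕ → ℝ) (P : IntervalFamily) :
    familyNorm x P ^ 2 = ∑ I ∈ P.1, (∑ k ∈ I, x k) ^ 2 := by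
  rw [familyNorm, Real.sq_sqrt (by positivity)]
  simp

theorem norm_le_of_familyNorm_le (x : JamesSpace) {C : ℝ} (h : ∀ P, familyNorm x P ≤ C) :
    ‖x‖ ≤ C := ciSup_le h

theorem norm_sq_le_of_sum_sq_le (x : JamesSpace) {C : ℝ}
    (h : ∀ P : IntervalFamily, ∑ I ∈ P.1, (∑ k ∈ I, x k) ^ 2 ≤ C) : ‖x‖ ^ 2 ≤ C := by
  have hC : 0 ≤ C := by simpa using h ⟨∅, by simp, by simp⟩
  rw [← Real.le_sqrt (norm_nonneg x) hC]
  refine x.norm_le_of_familyNorm_le fun P => Real.le_sqrt_of_sq_le ?_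
  rw [familyNorm_sq]
  exact h P

theorem exists_of_sum_sq_le (z : ℕ → ℝ) {C : ℝ} (hC : 0 ≤ C)
    (h : ∀ P : IntervalFamily, ∑ I ∈ P.1, (∑ k ∈ I, z k) ^ 2 ≤ C ^ 2) :
    ∃ w : JamesSpace, (w : ℕ → ℝ) = z ∧ ‖w‖ ≤ C := by
  have h' : ∀ P, familyNorm z P ≤ C := fun P =>
    abs_le_of_sq_le_sq' (by rw [familyNorm_sq]; exact h P) hC |>.2
  exact ⟨⟨z, C, by rintro _ ⟨P, rfl⟩; exact h' P⟩, rfl, norm_le_of_familyNorm_le _ h'⟩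

/-- A sequence whose sums over intervals are sums of `x` over corresponding intervals has norm at
most that of `x`. -/
theorem exists_norm_le (x : JamesSpace) (z : ℕ → ℝ) (φ : Finset ℕ → Finset ℕ)
    (hφ : ∀ K : Finset ℕ, (K : Set ℕ).OrdConnected → (φ K : Set ℕ).OrdConnected)
    (hd : ∀ K L : Finset ℕ, (K : Set ℕ).OrdConnected → (L : Set ℕ).OrdConnected → Disjoint K L →
      Disjoint (φ K) (φ L))
    (hz : ∀ K : Finset ℕ, (K : Set ℕ).OrdConnected → ∑ k ∈ K, z k = ∑ k ∈ φ K, x k) :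
    ∃ w : JamesSpace, (w : ℕ → ℝ) = z ∧ ‖w‖ ≤ ‖x‖ := by
  refine exists_of_sum_sq_le z (norm_nonneg x) fun P => ?_
  rw [Finset.sum_congr rfl fun K hK => by rw [hz K (P.2.1 K hK)]]
  exact x.sum_sq_le_norm_sq P.1 φ (fun K hK => hφ K (P.2.1 K hK))
    fun K hK L hL hne => hd K L (P.2.1 K hK) (P.2.1 L hL) (P.2.2 hK hL hne)

theorem ext {x y : JamesSpace} (h : ∀ n, x n = y n) : x = y := Subtype.ext (funext h)

theorem coe_sub (x y : JamesSpace) : ((x - y : JamesSpace) : ℕ → ℝ) = x - y := rfl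

theorem coe_sum {ι : Type*} (s : Finset ι) (f : ι → JamesSpace) (n : ℕ) :
    (∑ i ∈ s, f i : JamesSpace) n = ∑ i ∈ s, f i n := by
  classical
  induction s using Finset.induction_on with
  | empty => rfl
  | insert i s hi ih => rw [Finset.sum_insert hi, Finset.sum_insert hi, coe_add, Pi.add_apply, ih]

/-- The coordinate functionals. -/
noncomputable def coord (n : ℕ) : StrongDual ℝ JamesSpace :=
  LinearMap.mkContinuous
    { toFun := fun x => x n
      map_add' := fun _ _ => rfl
      map_smul' := fun _ _ => rfl } 1 fun x => by
    rw [one_mul]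
    change |x n| ≤ ‖x‖
    simpa using x.abs_sum_le_norm {n} (by simpa using Set.ordConnected_singleton)

theorem coord_apply (n : ℕ) (x : JamesSpace) : coord n x = x n := rfl

theorem abs_apply_le_norm (x : JamesSpace) (n : ℕ) : |x n| ≤ ‖x‖ := by
  simpa using x.abs_sum_le_norm {n} (by simpa using Set.ordConnected_singleton)

theorem exists_single (n : ℕ) :
    ∃ w : JamesSpace, (w : ℕ → ℝ) = Pi.single n 1 ∧ ‖w‖ ≤ 1 := by
  refine exists_of_sum_sq_le _ zero_le_one fun P => ?_
  have h : ∀ K : Finset ℕ, (∑ k ∈ K, (Pi.single n 1 : ℕ → ℝ) k) ^ 2 = if n ∈ K then 1 else 0 := by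
    intro K
    simp [Pi.single_apply]
  simp only [h, one_pow]
  rw [← Finset.sum_filter]
  simp only [Finset.sum_const, nsmul_eq_mul, mul_one]
  norm_cast
  rw [Finset.card_le_one]
  intro K hK L hL
  by_contra hne
  rw [Finset.mem_filter] at hK hL
  exact Finset.disjoint_left.mp (P.2.2 hK.1 hL.1 hne) hK.2 hL.2

/-- The unit vectors. -/
noncomputable def single (n : ℕ) : JamesSpace := (exists_single n).choose

theorem coe_single (n : ℕ) : (single n : ℕ → ℝ) = Pi.single n 1 := (exists_single n).choose_spec.1

theorem norm_single_le (n : ℕ) : ‖single n‖ ≤ 1 := (exists_single n).choose_spec.2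

theorem single_apply (m n : ℕ) : single m n = if n = m then 1 else 0 := by
  rw [coe_single, Pi.single_apply]

/-! ### Truncations and superadditivity of the squared norm -/

theorem ordConnected_filter {K : Finset ℕ} (hK : (K : Set ℕ).OrdConnected) (p : ℕ → Prop)
    [DecidablePred p] (hp : {n | p n}.OrdConnected) : (K.filter p : Set ℕ).OrdConnected := by
  rw [Finset.coe_filter, Set.ofPred_and]
  exact hK.inter hp

theorem exists_restrict (x : JamesSpace) (p : ℕ → Prop) [DecidablePred p]
    (hp : {n | p n}.OrdConnected) :
    ∃ w : JamesSpace, (w : ℕ → ℝ) = (fun n => if p n then x n else 0) ∧ ‖w‖ ≤ ‖x‖ := by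
  refine x.exists_norm_le _ (fun K => K.filter p) (fun K hK => ordConnected_filter hK p hp)
    (fun K L _ _ h => Finset.disjoint_filter_filter h) fun K _ => ?_
  rw [Finset.sum_filter]

theorem ordConnected_lt (n : ℕ) : {k | k < n}.OrdConnected := Set.ordConnected_Iio

theorem ordConnected_ge (n : ℕ) : {k | n ≤ k}.OrdConnected := Set.ordConnected_Ici

/-- The part of a sequence in `[0, n)`. -/
noncomputable def low (n : ℕ) (x : JamesSpace) : JamesSpace :=
  (x.exists_restrict (· < n) (ordConnected_lt n)).choose

/-- The part of a sequence in `[n, ∞)`. -/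
noncomputable def high (n : ℕ) (x : JamesSpace) : JamesSpace :=
  (x.exists_restrict (n ≤ ·) (ordConnected_ge n)).choose

theorem low_apply (n : ℕ) (x : JamesSpace) (k : ℕ) : low n x k = if k < n then x k else 0 :=
  congrFun (x.exists_restrict (· < n) (ordConnected_lt n)).choose_spec.1 k

theorem high_apply (n : ℕ) (x : JamesSpace) (k : ℕ) : high n x k = if n ≤ k then x k else 0 :=
  congrFun (x.exists_restrict (n ≤ ·) (ordConnected_ge n)).choose_spec.1 k

theorem sum_low (n : ℕ) (x : JamesSpace) (K : Finset ℕ) :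
    ∑ k ∈ K, low n x k = ∑ k ∈ K.filter (· < n), x k := by
  rw [Finset.sum_filter]
  exact Finset.sum_congr rfl fun k _ => low_apply n x k

theorem sum_high (n : ℕ) (x : JamesSpace) (K : Finset ℕ) :
    ∑ k ∈ K, high n x k = ∑ k ∈ K.filter (n ≤ ·), x k := by
  rw [Finset.sum_filter]
  exact Finset.sum_congr rfl fun k _ => high_apply n x k

theorem low_add_high (n : ℕ) (x : JamesSpace) : low n x + high n x = x := by
  refine ext fun k => ?_
  rw [coe_add, Pi.add_apply, low_apply, high_apply]
  split_ifs <;> first | omega | simp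

theorem low_eq_sum (n : ℕ) (x : JamesSpace) : low n x = ∑ k ∈ Finset.range n, x k • single k := by
  refine ext fun k => ?_
  rw [coe_sum, low_apply]
  simp only [coe_smul, Pi.smul_apply, single_apply, smul_eq_mul, mul_ite, mul_one, mul_zero]
  simp

/-- Superadditivity of the squared norm over successive intervals. -/
theorem norm_low_sq_add_norm_high_sq_le (x : JamesSpace) {a b : ℕ} (hab : a ≤ b) :
    ‖low a x‖ ^ 2 + (∑ k ∈ Finset.Ico a b, x k) ^ 2 + ‖high b x‖ ^ 2 ≤ ‖x‖ ^ 2 := by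
  have key : ∀ P Q : IntervalFamily, ∑ K ∈ P.1, (∑ k ∈ K, low a x k) ^ 2 +
      (∑ k ∈ Finset.Ico a b, x k) ^ 2 + ∑ K ∈ Q.1, (∑ k ∈ K, high b x k) ^ 2 ≤ ‖x‖ ^ 2 := by
    intro P Q
    -- One family is made of `P` cut to `[0, a)`, the interval `[a, b)` and `Q` cut to `[b, ∞)`; the
    -- suprema over `P` and over `Q` are taken afterwards, one at a time.
    have h := x.sum_sq_le_norm_sq (P.1.disjSum (Finset.disjSum {()} Q.1))
      (Sum.elim (fun K => K.filter (· < a)) (Sum.elim (fun _ => Finset.Ico a b)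
        (fun K => K.filter (b ≤ ·)))) ?_ ?_
    · rw [Finset.sum_disjSum, Finset.sum_disjSum] at h
      simp only [Sum.elim_inl, Sum.elim_inr, Finset.sum_singleton] at h
      simp only [sum_low, sum_high]
      linarith
    · rintro (K | K | K) hK
      · simp only [Finset.inl_mem_disjSum] at hK
        exact ordConnected_filter (P.2.1 K hK) _ (ordConnected_lt a)
      · simpa using Set.ordConnected_Ico
      · simp only [Finset.inr_mem_disjSum] at hK
        exact ordConnected_filter (Q.2.1 K hK) _ (ordConnected_ge b)
    · rintro (K | K | K) hK (L | L | L) hL hne <;>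
        simp only [Finset.mem_coe, Finset.inl_mem_disjSum,
          Finset.inr_mem_disjSum] at hK hL <;>
        simp only [Function.onFun, Sum.elim_inl, Sum.elim_inr]
      · exact Finset.disjoint_filter_filter (P.2.2 hK hL fun h => hne (by rw [h]))
      · rw [Finset.disjoint_left]; intro n h1 h2; simp at h1 h2; omega
      · rw [Finset.disjoint_left]; intro n h1 h2; simp at h1 h2; omega
      · rw [Finset.disjoint_left]; intro n h1 h2; simp at h1 h2; omega
      · exact absurd rfl hne
      · rw [Finset.disjoint_left]; intro n h1 h2; simp at h1 h2; omega
      · rw [Finset.disjoint_left]; intro n h1 h2; simp at h1 h2; omega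
      · rw [Finset.disjoint_left]; intro n h1 h2; simp at h1 h2; omega
      · exact Finset.disjoint_filter_filter (Q.2.2 hK hL fun h => hne (by rw [h]))
  have h1 : ∀ Q : IntervalFamily, ‖low a x‖ ^ 2 ≤ ‖x‖ ^ 2 - (∑ k ∈ Finset.Ico a b, x k) ^ 2 -
      ∑ K ∈ Q.1, (∑ k ∈ K, high b x k) ^ 2 := fun Q =>
    norm_sq_le_of_sum_sq_le _ fun P => by linarith [key P Q]
  have h2 : ‖high b x‖ ^ 2 ≤ ‖x‖ ^ 2 - (∑ k ∈ Finset.Ico a b, x k) ^ 2 - ‖low a x‖ ^ 2 :=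
    norm_sq_le_of_sum_sq_le _ fun Q => by linarith [h1 Q]
  linarith

theorem norm_low_sq_add_norm_high_sq_le' (x : JamesSpace) (a : ℕ) :
    ‖low a x‖ ^ 2 + ‖high a x‖ ^ 2 ≤ ‖x‖ ^ 2 := by
  simpa using x.norm_low_sq_add_norm_high_sq_le le_rfl (a := a)

/-- A family is finite with bounded intervals, so its value is already attained on a truncation. -/
theorem tendsto_norm_low_sq (x : JamesSpace) :
    Tendsto (fun n => ‖low n x‖ ^ 2) atTop (𝓝 (‖x‖ ^ 2)) := by
  rw [Metric.tendsto_atTop]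
  intro ε hε
  by_contra! hcon
  have hle : ‖x‖ ^ 2 ≤ ‖x‖ ^ 2 - ε := by
    refine x.norm_sq_le_of_sum_sq_le fun P => ?_
    obtain ⟨n, hn, hdist⟩ := hcon ((P.1.biUnion id).sup Nat.succ)
    have hs : ∀ K ∈ P.1, (∑ k ∈ K, x k) = ∑ k ∈ K, low n x k := by
      intro K hK
      refine Finset.sum_congr rfl fun k hk => ?_
      have h2 : Nat.succ k ≤ (P.1.biUnion id).sup Nat.succ :=
        Finset.le_sup (f := Nat.succ) (Finset.mem_biUnion.mpr ⟨K, hK, hk⟩)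
      rw [low_apply, if_pos (by omega)]
    have h3 : ∑ K ∈ P.1, (∑ k ∈ K, x k) ^ 2 ≤ ‖low n x‖ ^ 2 := by
      rw [Finset.sum_congr rfl fun K hK => by rw [hs K hK]]
      exact (low n x).sum_sq_le_norm_sq P.1 id P.2.1 P.2.2
    have h4 : ‖low n x‖ ^ 2 ≤ ‖x‖ ^ 2 := by
      nlinarith [x.norm_low_sq_add_norm_high_sq_le' n, sq_nonneg ‖high n x‖]
    rw [Real.dist_eq, abs_sub_comm, abs_of_nonneg (by linarith)] at hdist
    linarith
  linarith

/-- Superadditivity bounds `‖high n x‖²` by `‖x‖² - ‖low n x‖²`. Hence the unit vectors form a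
Schauder basis, and a functional is determined by its values on them (`dual_ext`). -/
theorem tendsto_norm_high (x : JamesSpace) : Tendsto (fun n => ‖high n x‖) atTop (𝓝 0) := by
  have h : Tendsto (fun n => ‖high n x‖ ^ 2) atTop (𝓝 0) := by
    refine squeeze_zero (fun n => sq_nonneg _)
      (fun n => le_sub_iff_add_le'.mpr (x.norm_low_sq_add_norm_high_sq_le' n)) ?_
    rw [← sub_self (‖x‖ ^ 2)]
    exact x.tendsto_norm_low_sq.const_sub _
  simpa using h.sqrt

theorem tendsto_low (x : JamesSpace) : Tendsto (fun n => low n x) atTop (𝓝 x) := by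
  rw [tendsto_iff_norm_sub_tendsto_zero]
  refine x.tendsto_norm_high.congr fun n => ?_
  rw [← norm_neg]
  congr 1
  rw [neg_eq_iff_eq_neg, neg_sub, eq_sub_iff_add_eq, add_comm]
  exact low_add_high n x

theorem tendsto_apply_low (f : StrongDual ℝ JamesSpace) (x : JamesSpace) :
    Tendsto (fun n => ∑ k ∈ Finset.range n, x k * f (single k)) atTop (𝓝 (f x)) := by
  refine ((f.continuous.tendsto x).comp x.tendsto_low).congr fun n => ?_
  simp [low_eq_sum]

theorem dual_ext {f g : StrongDual ℝ JamesSpace} (h : ∀ n, f (single n) = g (single n)) :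
    f = g := by
  ext x
  refine tendsto_nhds_unique (tendsto_apply_low f x) ?_
  simp only [h]
  exact tendsto_apply_low g x

/-! ### Extreme points of the unit ball of the James space -/

theorem sum_range_sq_le (x : JamesSpace) (n : ℕ) : ∑ k ∈ Finset.range n, x k ^ 2 ≤ ‖x‖ ^ 2 := by
  simpa using x.sum_sq_le_norm_sq (Finset.range n) (fun k => {k})
    (fun i _ => by simpa using Set.ordConnected_singleton)
    (fun i _ j _ h => by simpa [Function.onFun] using h)

theorem summable_sq (x : JamesSpace) : Summable fun n => x n ^ 2 :=
  summable_of_sum_range_le (fun _ => sq_nonneg _) x.sum_range_sq_le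

theorem tsum_sq_le (x : JamesSpace) : ∑' n, x n ^ 2 ≤ ‖x‖ ^ 2 :=
  x.summable_sq.tsum_le_of_sum_range_le x.sum_range_sq_le

/-- Peels off the first interval of a nearly optimal family on `[a, ∞)`. The interval containing `a`
becomes `[a, d)` and all others lie beyond `d`; if no interval contains `a`, then `d = a + 1`
serves. -/
theorem exists_lt_of_lt_norm_high_sq (x : JamesSpace) (a : ℕ) {u : ℝ} (hu : u < ‖high a x‖ ^ 2) :
    ∃ d, a < d ∧ u < (∑ k ∈ Finset.Ico a d, x k) ^ 2 + ‖high d x‖ ^ 2 := by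
  classical
  by_contra! hcon
  refine absurd (norm_sq_le_of_sum_sq_le (high a x) fun P => ?_) (not_le.mpr hu)
  by_cases h : ∃ K ∈ P.1, a ∈ K
  · obtain ⟨K, hK, haK⟩ := h
    obtain ⟨d, hd⟩ : ∃ d, d = K.sup Nat.succ := ⟨_, rfl⟩
    have hlt : ∀ k ∈ K, k < d := fun k hk => hd ▸ Finset.le_sup (f := Nat.succ) hk
    obtain ⟨t, htK, ht⟩ := Finset.exists_mem_eq_sup K ⟨a, haK⟩ Nat.succ
    have hKa : K.filter (a ≤ ·) = Finset.Ico a d := by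
      ext n
      rw [Finset.mem_filter, Finset.mem_Ico]
      refine ⟨fun h => ⟨h.2, hlt n h.1⟩, fun h => ⟨?_, h.1⟩⟩
      exact (P.2.1 K hK).out haK htK ⟨h.1, by omega⟩
    rw [← Finset.add_sum_erase _ _ hK, sum_high, hKa]
    refine le_trans (add_le_add_right ?_ _) (hcon d (hlt a haK))
    have hs : ∀ L ∈ P.1.erase K, ∑ k ∈ L, high a x k = ∑ k ∈ L, high d x k := by
      intro L hL
      rw [sum_high, sum_high]
      congr 1
      ext n
      rw [Finset.mem_filter, Finset.mem_filter]
      refine and_congr_right fun hn => ⟨fun h => ?_, fun h => (hlt a haK).le.trans h⟩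
      by_contra hnd
      have hnK : n ∈ K := (P.2.1 K hK).out haK htK ⟨h, by omega⟩
      exact Finset.disjoint_left.mp (P.2.2 (Finset.mem_of_mem_erase hL) hK
        (Finset.ne_of_mem_erase hL)) hn hnK
    rw [Finset.sum_congr rfl fun L hL => by rw [hs L hL]]
    exact (high d x).sum_sq_le_norm_sq _ id (fun L hL => P.2.1 L (Finset.mem_of_mem_erase hL))
      (P.2.2.mono (Finset.coe_subset.mpr (Finset.erase_subset _ _)))
  · push Not at h
    refine le_trans ?_ ((le_add_of_nonneg_left (sq_nonneg _)).trans (hcon (a + 1) (by omega)))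
    have hs : ∀ L ∈ P.1, ∑ k ∈ L, high a x k = ∑ k ∈ L, high (a + 1) x k := by
      intro L hL
      rw [sum_high, sum_high]
      congr 1
      ext n
      rw [Finset.mem_filter, Finset.mem_filter]
      refine and_congr_right fun hn => ⟨fun h' => ?_, fun h' => by omega⟩
      rcases h'.eq_or_lt with rfl | h'
      · exact absurd hn (h L hL)
      · exact h'
    rw [Finset.sum_congr rfl fun L hL => by rw [hs L hL]]
    exact (high (a + 1) x).sum_sq_le_norm_sq _ id P.2.1 P.2.2

/-- Mirror image of the preceding lemma: the last interval of a nearly optimal family on `[0, a]` is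
peeled off. -/
theorem exists_lt_of_lt_norm_low_sq (x : JamesSpace) (a : ℕ) {u : ℝ}
    (hu : u < ‖low (a + 1) x‖ ^ 2) :
    ∃ c, c ≤ a ∧ u < ‖low c x‖ ^ 2 + (∑ k ∈ Finset.Ico c (a + 1), x k) ^ 2 := by
  classical
  by_contra! hcon
  refine absurd (norm_sq_le_of_sum_sq_le (low (a + 1) x) fun P => ?_) (not_le.mpr hu)
  by_cases h : ∃ K ∈ P.1, a ∈ K
  · obtain ⟨K, hK, haK⟩ := h
    obtain ⟨c, hcK, hc⟩ : ∃ c ∈ K, ∀ k ∈ K, c ≤ k :=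
      ⟨K.min' ⟨a, haK⟩, K.min'_mem _, fun k hk => K.min'_le k hk⟩
    have hKa : K.filter (· < a + 1) = Finset.Ico c (a + 1) := by
      ext n
      rw [Finset.mem_filter, Finset.mem_Ico]
      refine ⟨fun h => ⟨hc n h.1, h.2⟩, fun h => ⟨?_, h.2⟩⟩
      exact (P.2.1 K hK).out hcK haK ⟨h.1, by omega⟩
    rw [← Finset.add_sum_erase _ _ hK, sum_low, hKa, add_comm]
    refine le_trans (add_le_add_left ?_ _) (hcon c (hc a haK))
    have hs : ∀ L ∈ P.1.erase K, ∑ k ∈ L, low (a + 1) x k = ∑ k ∈ L, low c x k := by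
      intro L hL
      rw [sum_low, sum_low]
      congr 1
      ext n
      rw [Finset.mem_filter, Finset.mem_filter]
      refine and_congr_right fun hn => ⟨fun h => ?_, fun h => by have := hc a haK; omega⟩
      by_contra hnd
      have hnK : n ∈ K := (P.2.1 K hK).out hcK haK ⟨by omega, by omega⟩
      exact Finset.disjoint_left.mp (P.2.2 (Finset.mem_of_mem_erase hL) hK
        (Finset.ne_of_mem_erase hL)) hn hnK
    rw [Finset.sum_congr rfl fun L hL => by rw [hs L hL]]
    exact (low c x).sum_sq_le_norm_sq _ id (fun L hL => P.2.1 L (Finset.mem_of_mem_erase hL))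
      (P.2.2.mono (Finset.coe_subset.mpr (Finset.erase_subset _ _)))
  · push Not at h
    refine le_trans ?_ ((le_add_of_nonneg_right (sq_nonneg _)).trans (hcon a le_rfl))
    have hs : ∀ L ∈ P.1, ∑ k ∈ L, low (a + 1) x k = ∑ k ∈ L, low a x k := by
      intro L hL
      rw [sum_low, sum_low]
      congr 1
      ext n
      rw [Finset.mem_filter, Finset.mem_filter]
      refine and_congr_right fun hn => ⟨fun h' => ?_, fun h' => by omega⟩
      rcases (Nat.lt_succ_iff.mp h').eq_or_lt with rfl | h'
      · exact absurd hn (h L hL)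
      · exact h'
    rw [Finset.sum_congr rfl fun L hL => by rw [hs L hL]]
    exact (low a x).sum_sq_le_norm_sq _ id P.2.1 P.2.2

/-- If the squared norm splits at `a` and at `a + 1`, then it splits at both places at once. -/
theorem norm_sq_eq_of_split (x : JamesSpace) (a : ℕ)
    (h0 : ‖low a x‖ ^ 2 + ‖high a x‖ ^ 2 = ‖x‖ ^ 2)
    (h1 : ‖low (a + 1) x‖ ^ 2 + ‖high (a + 1) x‖ ^ 2 = ‖x‖ ^ 2) :
    ‖low a x‖ ^ 2 + x a ^ 2 + ‖high (a + 1) x‖ ^ 2 = ‖x‖ ^ 2 := by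
  have hle := x.norm_low_sq_add_norm_high_sq_le (Nat.le_succ a)
  rw [Nat.succ_eq_add_one, Nat.Ico_succ_singleton, Finset.sum_singleton] at hle
  refine le_antisymm hle ?_
  by_contra! hlt
  set ε := ‖x‖ ^ 2 - (‖low a x‖ ^ 2 + x a ^ 2 + ‖high (a + 1) x‖ ^ 2) with hε
  have hε0 : 0 < ε := by linarith
  obtain ⟨d, had, hd⟩ := x.exists_lt_of_lt_norm_high_sq a
    (u := ‖high a x‖ ^ 2 - ε / 4) (by linarith)
  obtain ⟨c, hca, hc⟩ := x.exists_lt_of_lt_norm_low_sq a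
    (u := ‖low (a + 1) x‖ ^ 2 - ε / 4) (by linarith)
  rw [Finset.sum_Ico_succ_top (by omega)] at hc
  rw [Finset.sum_eq_sum_Ico_succ_bot had] at hd
  have h2 := x.norm_low_sq_add_norm_high_sq_le (a := c) (b := d) (by omega)
  rw [← Finset.sum_Ico_consecutive _ hca had.le, Finset.sum_eq_sum_Ico_succ_bot had] at h2
  have h3 := (low a x).norm_low_sq_add_norm_high_sq_le (a := c) (b := a) hca
  have e3 : low c (low a x) = low c x := ext fun k => by
    simp only [low_apply]; split_ifs <;> first | omega | rfl
  have e3' : ∑ k ∈ Finset.Ico c a, low a x k = ∑ k ∈ Finset.Ico c a, x k :=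
    Finset.sum_congr rfl fun k hk => by
      rw [low_apply, if_pos (Finset.mem_Ico.mp hk).2]
  have h4 := (high (a + 1) x).norm_low_sq_add_norm_high_sq_le (a := a + 1) (b := d) had
  have e4 : high d (high (a + 1) x) = high d x := ext fun k => by
    simp only [high_apply]; split_ifs <;> first | omega | rfl
  have e4' : ∑ k ∈ Finset.Ico (a + 1) d, high (a + 1) x k = ∑ k ∈ Finset.Ico (a + 1) d, x k :=
    Finset.sum_congr rfl fun k hk => by
      rw [high_apply, if_pos (Finset.mem_Ico.mp hk).1]
  rw [e3, e3'] at h3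
  rw [e4, e4'] at h4
  set p := ∑ k ∈ Finset.Ico c a, x k
  set q := x a
  set r := ∑ k ∈ Finset.Ico (a + 1) d, x k
  have h3n := sq_nonneg ‖high a (low a x)‖
  have h4n := sq_nonneg ‖low (a + 1) (high (a + 1) x)‖
  -- Splitting at `a + 1` makes `[c, a]` nearly optimal, so joining `q` to `p` beats keeping them
  -- apart, which forces `pq > 0`; splitting at `a` gives `qr > 0` likewise. Thus all three have one
  -- sign, and `(p + q)² + (q + r)² = (p + q + r)² + q² - 2pr` makes the merged interval `[c, d)`
  -- exceed `‖x‖²`.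
  have hpq : 0 < p * q := by nlinarith
  have hqr : 0 < q * r := by nlinarith
  have hpr : 0 < p * r := by
    have : 0 < (p * r) * q ^ 2 := by nlinarith [mul_pos hpq hqr]
    exact pos_of_mul_pos_left this (sq_nonneg q)
  nlinarith

instance : Nontrivial JamesSpace := ⟨⟨single 0, 0, fun h => by
  have := congrArg (fun y : JamesSpace => y 0) h
  simp [single_apply, coe_zero] at this⟩⟩

theorem familyNorm_sq_le_of_split (x : JamesSpace) (n : ℕ) (P : IntervalFamily)
    (hP : ∀ K ∈ P.1, (∀ k ∈ K, k < n) ∨ ∀ k ∈ K, n ≤ k) :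
    familyNorm x P ^ 2 ≤ ‖low n x‖ ^ 2 + ‖high n x‖ ^ 2 := by
  classical
  rw [familyNorm_sq, ← Finset.sum_filter_add_sum_filter_not _ (fun K => ∀ k ∈ K, k < n)]
  refine add_le_add ?_ ?_
  · rw [Finset.sum_congr rfl fun K hK => by
      rw [show ∑ k ∈ K, x k = ∑ k ∈ K, low n x k from Finset.sum_congr rfl fun k hk => by
        rw [low_apply, if_pos ((Finset.mem_filter.mp hK).2 k hk)]]]
    exact (low n x).sum_sq_le_norm_sq _ id (fun L hL => P.2.1 L (Finset.mem_filter.mp hL).1)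
      (P.2.2.mono (Finset.coe_subset.mpr (Finset.filter_subset _ _)))
  · rw [Finset.sum_congr rfl fun K hK => by
      rw [show ∑ k ∈ K, x k = ∑ k ∈ K, high n x k from Finset.sum_congr rfl fun k hk => by
        rw [high_apply, if_pos (((hP K (Finset.mem_filter.mp hK).1).resolve_left
          (Finset.mem_filter.mp hK).2) k hk)]]]
    exact (high n x).sum_sq_le_norm_sq _ id (fun L hL => P.2.1 L (Finset.mem_filter.mp hL).1)
      (P.2.2.mono (Finset.coe_subset.mpr (Finset.filter_subset _ _)))

/-- A family with an interval containing both `n` and `n + 1` does not see `e_n - e_{n+1}`. Every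
other family splits at `n + 1`, and its value on `x` is at most the square root in `hε`, which
leaves room for the perturbation. -/
theorem norm_add_smul_sub_single_le (x : JamesSpace) (hx : ‖x‖ ≤ 1) (n : ℕ) {ε : ℝ}
    (hε : √(‖low (n + 1) x‖ ^ 2 + ‖high (n + 1) x‖ ^ 2) + |ε| * ‖single n - single (n + 1)‖ ≤ 1) :
    ‖x + ε • (single n - single (n + 1))‖ ≤ 1 := by
  set e := single n - single (n + 1) with he
  refine norm_le_of_familyNorm_le _ fun P => ?_
  by_cases h : ∀ K ∈ P.1, (∀ k ∈ K, k < n + 1) ∨ ∀ k ∈ K, n + 1 ≤ k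
  · rw [coe_add]
    refine (familyNorm_add_le _ _ _).trans (le_trans (add_le_add ?_ ?_) hε)
    · exact Real.le_sqrt_of_sq_le (x.familyNorm_sq_le_of_split _ P h)
    · rw [coe_smul, familyNorm_smul]
      exact mul_le_mul_of_nonneg_left (e.familyNorm_le_norm P) (abs_nonneg _)
  · push Not at h
    obtain ⟨K, hK, ⟨b, hb, hbn⟩, ⟨a, ha, han⟩⟩ := h
    have h1 : n ∈ K := (P.2.1 K hK).out ha hb ⟨by omega, by omega⟩
    have h2 : n + 1 ∈ K := (P.2.1 K hK).out ha hb ⟨by omega, by omega⟩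
    have hL : ∀ L ∈ P.1, ∑ k ∈ L, e k = 0 := by
      intro L hL
      have hiff : n ∈ L ↔ n + 1 ∈ L := by
        by_cases hLK : L = K
        · simp [hLK, h1, h2]
        · have hd := Finset.disjoint_left.mp (P.2.2 hL hK hLK)
          exact ⟨fun h => absurd h1 (hd h), fun h => absurd h2 (hd h)⟩
      simp only [he, coe_sub, Pi.sub_apply, Finset.sum_sub_distrib, single_apply,
        Finset.sum_ite_eq']
      simp [hiff]
    have : familyNorm (x + ε • e : JamesSpace) P = familyNorm x P := by
      unfold familyNorm
      congr 1
      refine Finset.sum_congr rfl fun L hL' => ?_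
      rw [coe_add, coe_smul]
      simp only [Pi.add_apply, Pi.smul_apply, Finset.sum_add_distrib, ← Finset.smul_sum, hL L hL']
      simp
    rw [this]
    exact (x.familyNorm_le_norm P).trans hx

theorem norm_eq_one_of_mem_extremePoints {x : JamesSpace}
    (hx : x ∈ Set.extremePoints ℝ (Metric.closedBall (0 : JamesSpace) 1)) : ‖x‖ = 1 := by
  simpa using extremePoints_closedBall_subset_sphere hx

/-- With strict inequality at a cut after `n`, both `x ± ε(e_n - e_{n+1})` would stay in the ball
for small `ε`. The cut at `0` is trivial. -/
theorem split_of_mem_extremePoints {x : JamesSpace}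
    (hx : x ∈ Set.extremePoints ℝ (Metric.closedBall (0 : JamesSpace) 1)) (n : ℕ) :
    ‖low n x‖ ^ 2 + ‖high n x‖ ^ 2 = 1 := by
  have hx1 := norm_eq_one_of_mem_extremePoints hx
  have hle := x.norm_low_sq_add_norm_high_sq_le' n
  rw [hx1, one_pow] at hle
  rcases n with _ | n
  · have h : high 0 x = x := ext fun k => by simp [high_apply]
    rw [h, hx1] at hle ⊢
    nlinarith [sq_nonneg ‖low 0 x‖]
  by_contra hne
  have hlt := lt_of_le_of_ne hle hne
  set s := √(‖low (n + 1) x‖ ^ 2 + ‖high (n + 1) x‖ ^ 2) with hs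
  have hs1 : s < 1 := by rw [hs, Real.sqrt_lt' one_pos]; simpa using hlt
  set e := single n - single (n + 1) with he
  have he2 : ‖e‖ ≤ 2 := (norm_sub_le _ _).trans
    (by linarith [norm_single_le n, norm_single_le (n + 1)])
  -- Half of the slack `1 - s`, because `‖e‖ ≤ 2`.
  set ε := (1 - s) / 2 with hε
  have hε0 : 0 < ε := by linarith
  have hb : s + |ε| * ‖e‖ ≤ 1 := by
    rw [abs_of_pos hε0]
    nlinarith
  have h1 := x.norm_add_smul_sub_single_le hx1.le n (ε := ε) hb
  have h2 := x.norm_add_smul_sub_single_le hx1.le n (ε := -ε) (by rwa [abs_neg])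
  have h3 := hx.2 (x₁ := x + ε • e) (by simpa using h1) (x₂ := x + (-ε) • e) (by simpa using h2)
    ⟨1 / 2, 1 / 2, by norm_num, by norm_num, by norm_num, by module⟩
  have h4 := congrArg (fun y : JamesSpace => y n) h3
  simp [coe_add, coe_smul, he, coe_sub, single_apply] at h4
  exact hε0.ne' h4

/-- An extreme point of the unit ball of `J` is a unit vector of `ℓ²`. -/
theorem hasSum_sq_of_mem_extremePoints {x : JamesSpace}
    (hx : x ∈ Set.extremePoints ℝ (Metric.closedBall (0 : JamesSpace) 1)) :
    HasSum (fun n => x n ^ 2) 1 := by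
  have hx1 := norm_eq_one_of_mem_extremePoints hx
  have hsplit := split_of_mem_extremePoints hx
  -- Splitting at `n` and at `n + 1` simultaneously shows that each coordinate adds exactly its
  -- square to `‖low n x‖²`.
  have hlow : ∀ n, ∑ k ∈ Finset.range n, x k ^ 2 = ‖low n x‖ ^ 2 := by
    intro n
    induction n with
    | zero =>
      have h : low 0 x = 0 := ext fun k => by simp [low_apply, coe_zero]
      simp [h]
    | succ n ih =>
      rw [Finset.sum_range_succ, ih]
      have h := x.norm_sq_eq_of_split n (by rw [hsplit, hx1, one_pow])
        (by rw [hsplit, hx1, one_pow])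
      rw [hx1, one_pow] at h
      linarith [hsplit (n + 1)]
  rw [hasSum_iff_tendsto_nat_of_nonneg fun n => sq_nonneg _]
  have h := x.tendsto_norm_low_sq
  rw [hx1, one_pow] at h
  exact h.congr fun n => (hlow n).symm

/-- A point of the unit ball of `J` which is a unit vector of `ℓ²` is extreme. -/
theorem mem_extremePoints_of_hasSum_sq {x : JamesSpace} (hx : ‖x‖ ≤ 1)
    (hs : HasSum (fun n => x n ^ 2) 1) :
    x ∈ Set.extremePoints ℝ (Metric.closedBall (0 : JamesSpace) 1) := by
  refine mem_extremePoints_iff_left.mpr ⟨by simpa using hx, fun y hy z hz hxyz => ?_⟩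
  obtain ⟨a, b, ha, hb, hab, rfl⟩ := hxyz
  rw [mem_closedBall_zero_iff] at hy hz
  have hle : ∀ w : JamesSpace, ‖w‖ ≤ 1 → ∑' n, w n ^ 2 ≤ 1 := fun w hw =>
    w.tsum_sq_le.trans (by nlinarith [norm_nonneg w])
  have h1 := ((y.summable_sq.hasSum.mul_left a).add (z.summable_sq.hasSum.mul_left b)).sub hs
  -- Strict convexity of ℓ²: the ℓ²-norm is at most the James norm, so `y` and `z` lie in the ball
  -- of ℓ² and the total defect `ab ∑ (y(n) - z(n))²` is at most zero.
  have hterm : ∀ n, a * y n ^ 2 + b * z n ^ 2 - ((a • y + b • z : JamesSpace) n) ^ 2 =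
      a * b * (y n - z n) ^ 2 := by
    intro n
    simp only [coe_add, coe_smul, Pi.add_apply, Pi.smul_apply, smul_eq_mul]
    obtain rfl : b = 1 - a := by linarith
    ring
  simp only [hterm] at h1
  have hyz : y = z := by
    refine ext fun n => ?_
    have h2 := le_hasSum h1 n fun k _ => by positivity
    have h3 : a * b * (y n - z n) ^ 2 ≤ 0 := by nlinarith [hle y hy, hle z hz]
    have h4 : (y n - z n) ^ 2 ≤ 0 := by
      by_contra h
      push Not at h
      exact absurd h3 (not_le.mpr (by positivity))
    exact sub_eq_zero.mp (pow_eq_zero_iff two_ne_zero |>.mp (le_antisymm h4 (sq_nonneg _)))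
  rw [hyz, ← add_smul, hab, one_smul]

end JamesSpace

/-! ### Milman's theorem -/

theorem IsCompact.convexJoin {E : Type*} [AddCommGroup E] [Module ℝ E] [TopologicalSpace E]
    [IsTopologicalAddGroup E] [ContinuousSMul ℝ E] {s t : Set E} (hs : IsCompact s)
    (ht : IsCompact t) : IsCompact (convexJoin ℝ s t) := by
  have h : _root_.convexJoin ℝ s t =
      (fun q : (E × E) × ℝ => q.1.1 + q.2 • (q.1.2 - q.1.1)) '' ((s ×ˢ t) ×ˢ Set.Icc 0 1) := by
    ext x
    simp only [mem_convexJoin, segment_eq_image', Set.mem_image, Set.mem_prod, Prod.exists]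
    constructor
    · rintro ⟨a, ha, b, hb, c, hc, rfl⟩
      exact ⟨a, b, c, ⟨⟨ha, hb⟩, hc⟩, rfl⟩
    · rintro ⟨a, b, c, ⟨⟨ha, hb⟩, hc⟩, rfl⟩
      exact ⟨a, ha, b, hb, c, hc, rfl⟩
  rw [h]
  exact ((hs.prod ht).prod isCompact_Icc).image (by fun_prop)

/-- Milman's converse of the Krein-Milman theorem: an extreme point of a compact convex set which
cannot be separated from a compact subset belongs to this subset. -/
theorem mem_of_mem_extremePoints_of_forall_le {E : Type*} [AddCommGroup E] [Module ℝ E]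
    [TopologicalSpace E] [IsTopologicalAddGroup E] [ContinuousSMul ℝ E] [LocallyConvexSpace ℝ E]
    [T2Space E] {B D : Set E} (hB : IsCompact B) (hBc : Convex ℝ B) (hD : IsCompact D)
    (hDB : D ⊆ B) {x : E} (hx : x ∈ B.extremePoints ℝ)
    (hle : ∀ (f : StrongDual ℝ E) (u : ℝ), (∀ d ∈ D, f d ≤ u) → f x ≤ u) : x ∈ D := by
  by_contra hxD
  have h : ∃ K : Set E, IsCompact K ∧ Convex ℝ K ∧ K ⊆ B ∧ D ⊆ K ∧ x ∉ K := by
    -- Compactness induction on being covered by a compact convex part of `B` that misses `x`.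
    -- Locally a closed half-space separates `d` from `x`; for unions the convex join works, as an
    -- extreme point on a segment in `B` is one of its ends.
    refine hD.induction_on (p := fun A => ∃ K : Set E, IsCompact K ∧ Convex ℝ K ∧ K ⊆ B ∧
      A ∩ D ⊆ K ∧ x ∉ K) ?_ ?_ ?_ ?_ |>.imp fun K hK => ?_
    · exact ⟨∅, isCompact_empty, convex_empty, by simp, by simp, by simp⟩
    · rintro s t hst ⟨K, h1, h2, h3, h4, h5⟩
      exact ⟨K, h1, h2, h3, (Set.inter_subset_inter_left _ hst).trans h4, h5⟩
    · rintro s t ⟨K, h1, h2, h3, h4, h5⟩ ⟨L, g1, g2, g3, g4, g5⟩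
      rw [Set.union_inter_distrib_right]
      rcases K.eq_empty_or_nonempty with rfl | hK
      · exact ⟨L, g1, g2, g3, Set.union_subset (h4.trans (Set.empty_subset _)) g4, g5⟩
      rcases L.eq_empty_or_nonempty with rfl | hL
      · exact ⟨K, h1, h2, h3, Set.union_subset h4 (g4.trans (Set.empty_subset _)), h5⟩
      refine ⟨convexJoin ℝ K L, h1.convexJoin g1, h2.convexJoin g2, convexJoin_subset h3 g3 hBc,
        Set.union_subset (h4.trans (subset_convexJoin_left hL))
          (g4.trans (subset_convexJoin_right hK)), fun hmem => ?_⟩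
      obtain ⟨a, ha, b, hb, hab⟩ := mem_convexJoin.mp hmem
      rcases (mem_extremePoints_iff_forall_segment.mp hx).2 a (h3 ha) b (g3 hb) hab with rfl | rfl
      · exact h5 ha
      · exact g5 hb
    · intro d hd
      obtain ⟨f, hf⟩ := geometric_hahn_banach_point_point
        (show d ≠ x from fun h => hxD (h ▸ hd))
      obtain ⟨u, hu1, hu2⟩ := exists_between hf
      refine ⟨{y | f y ≤ u}, mem_nhdsWithin_of_mem_nhds ?_, B ∩ {y | f y ≤ u}, ?_, ?_,
        Set.inter_subset_left, ?_, fun h => absurd h.2 (not_le.mpr hu2)⟩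
      · exact mem_of_superset ((isOpen_lt f.continuous continuous_const).mem_nhds hu1)
          fun y (hy : f y < u) => hy.le
      · exact hB.inter_right (isClosed_le f.continuous continuous_const)
      · exact hBc.inter (convex_halfSpace_le f.toLinearMap.isLinear u)
      · exact fun y hy => ⟨hDB hy.2, hy.1⟩
    · exact ⟨hK.1, hK.2.1, hK.2.2.1, by simpa using hK.2.2.2.1, hK.2.2.2.2⟩
  obtain ⟨K, hK, hKc, -, hDK, hxK⟩ := h
  obtain ⟨f, u, hf, hu⟩ := geometric_hahn_banach_closed_point hKc hK.isClosed hxK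
  exact absurd (hle f u fun d hd => (hf d (hDK hd)).le) (not_le.mpr hu)

/-! ### Step functionals: a weak* compact norming set -/

namespace JamesSpace

/-- The index of the block of `n` when `ℕ` is cut after each `t` with `T t`. -/
def blockIndex (T : ℕ → Bool) (n : ℕ) : ℕ := ∑ t ∈ Finset.range n, if T t then 1 else 0

theorem blockIndex_mono (T : ℕ → Bool) : Monotone (blockIndex T) := fun _ _ h =>
  Finset.sum_le_sum_of_subset (Finset.range_mono h)

theorem blockIndex_succ (T : ℕ → Bool) (n : ℕ) :
    blockIndex T (n + 1) = blockIndex T n + if T n then 1 else 0 := Finset.sum_range_succ _ _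

/-- The functionals in the unit ball of `J*` whose coefficients are constant on successive
blocks, the values on the blocks forming an element of the unit ball of `J`. -/
def stepDual : Set (StrongDual ℝ JamesSpace) :=
  {f | ‖f‖ ≤ 1 ∧ ∃ α : JamesSpace, ‖α‖ ≤ 1 ∧ ∃ T : ℕ → Bool,
    ∀ n, f (single n) = α (blockIndex T n)}

/-- Each family involves finitely many coordinates, so the ball is pointwise closed; it lies in the
compact cube `[-1, 1]^ℕ`. -/
theorem isCompact_coe_closedBall :
    IsCompact {a : ℕ → ℝ | ∃ α : JamesSpace, ‖α‖ ≤ 1 ∧ (α : ℕ → ℝ) = a} := by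
  have h : {a : ℕ → ℝ | ∃ α : JamesSpace, ‖α‖ ≤ 1 ∧ (α : ℕ → ℝ) = a} =
      ⋂ P : IntervalFamily, {a | familyNorm a P ≤ 1} := by
    ext a
    simp only [Set.mem_iInter]
    constructor
    · rintro ⟨α, hα, rfl⟩ P
      exact (α.familyNorm_le_norm P).trans hα
    · intro ha
      obtain ⟨w, hw, hw1⟩ := exists_of_sum_sq_le a zero_le_one fun P => by
        rw [← familyNorm_sq]
        exact pow_le_pow_left₀ (familyNorm_nonneg a P) (ha P) 2
      exact ⟨w, hw1, hw⟩
  refine (isCompact_univ_pi fun _ : ℕ => isCompact_Icc (a := (-1 : ℝ)) (b := 1)).of_isClosed_subset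
    ?_ ?_
  · rw [h]
    refine isClosed_iInter fun P => isClosed_le ?_ continuous_const
    unfold familyNorm
    fun_prop
  · rintro _ ⟨α, hα, rfl⟩ n -
    exact abs_le.mp ((α.abs_apply_le_norm n).trans hα)

/-- The pairs `(α, T)` range over a compact product, and each coefficient depends continuously on
them since `blockIndex T n` involves finitely many values of `T`. Compactness then follows from the
Banach–Alaoglu theorem. -/
theorem isCompact_stepDual :
    IsCompact (WeakDual.toStrongDual ⁻¹' stepDual : Set (WeakDual ℝ JamesSpace)) := by
  have hcont : Continuous fun q : (ℕ → ℝ) × (ℕ → Bool) => fun n => q.1 (blockIndex q.2 n) := by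
    refine continuous_pi fun n => ?_
    have h : ∀ q : (ℕ → ℝ) × (ℕ → Bool), q.1 (blockIndex q.2 n) =
        ∑ k ∈ Finset.range (n + 1), q.1 k * if blockIndex q.2 n = k then 1 else 0 := by
      intro q
      simp only [mul_ite, mul_one, mul_zero]
      rw [Finset.sum_ite_eq, if_pos]
      rw [Finset.mem_range, Nat.lt_succ_iff, blockIndex]
      refine (Finset.sum_le_card_nsmul _ _ 1 fun t _ => ?_).trans (by simp)
      split_ifs <;> simp
    simp only [h]
    refine continuous_finsetSum _ fun k _ => Continuous.mul (by fun_prop) ?_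
    have hj : Continuous fun T : ℕ → Bool => blockIndex T n :=
      continuous_finsetSum _ fun t _ =>
        (continuous_of_discreteTopology (f := fun b : Bool => if b then 1 else 0)).comp
          (continuous_apply t)
    exact (continuous_of_discreteTopology (f := fun m : ℕ => if m = k then (1 : ℝ) else 0)).comp
      (hj.comp continuous_snd)
  have hcomp := ((isCompact_coe_closedBall.prod (isCompact_univ (X := ℕ → Bool))).image hcont)
  have hev : Continuous fun f : WeakDual ℝ JamesSpace => fun n => f (single n) :=
    continuous_pi fun n => WeakDual.eval_continuous _
  have h := (WeakDual.isCompact_closedBall (𝕜 := ℝ) (E := JamesSpace) 0 1).inter_right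
    (hcomp.isClosed.preimage hev)
  convert h using 1
  ext f
  simp only [stepDual, Set.mem_preimage, Set.mem_ofPred_eq, Set.mem_inter_iff,
    mem_closedBall_zero_iff, Set.mem_image, Set.mem_prod, Set.mem_univ, and_true, Prod.exists]
  refine and_congr_right fun _ => ⟨?_, ?_⟩
  · rintro ⟨α, hα, T, hT⟩
    exact ⟨α, T, ⟨α, hα, rfl⟩, funext fun n => (hT n).symm⟩
  · rintro ⟨_, T, ⟨α, hα, rfl⟩, hT⟩
    exact ⟨α, hα, T, fun n => (congrFun hT n).symm⟩

/-- Group by the fibres of `j`, which are intervals, and apply Cauchy–Schwarz: the coefficients have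
ℓ²-norm at most `‖α‖`, the block sums at most `‖y‖`. -/
theorem mul_sum_coord_le {α y : JamesSpace} (j : ℕ → ℕ) (hj : Monotone j) (N : ℕ) :
    |∑ n ∈ Finset.range N, α (j n) * y n| ≤ ‖α‖ * ‖y‖ := by
  have hfib : ∑ n ∈ Finset.range N, α (j n) * y n =
      ∑ i ∈ (Finset.range N).image j, α i * ∑ n ∈ Finset.range N with j n = i, y n := by
    rw [← Finset.sum_fiberwise_of_maps_to (s := Finset.range N) (t := (Finset.range N).image j)
      (g := j) fun n hn => Finset.mem_image_of_mem j hn]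
    refine Finset.sum_congr rfl fun i _ => ?_
    rw [Finset.mul_sum]
    exact Finset.sum_congr rfl fun n hn => by rw [(Finset.mem_filter.mp hn).2]
  rw [hfib]
  refine abs_le_of_sq_le_sq ?_ (by positivity)
  refine (Finset.sum_mul_sq_le_sq_mul_sq _ _ _).trans ?_
  rw [mul_pow]
  refine mul_le_mul ?_ ?_ (by positivity) (by positivity)
  · simpa using α.sum_sq_le_norm_sq ((Finset.range N).image j) (fun k => {k})
      (fun i _ => by simpa using Set.ordConnected_singleton)
      (fun i _ j _ h => by simpa [Function.onFun] using h)
  · refine y.sum_sq_le_norm_sq _ (fun i => {n ∈ Finset.range N | j n = i}) (fun i _ => ?_)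
      fun i _ k _ h => ?_
    · refine ordConnected_filter (by simpa using Set.ordConnected_Iio) _ ?_
      exact (Set.ordConnected_singleton (a := i)).preimage_mono hj
    · exact Finset.disjoint_filter.mpr fun n _ h1 h2 => h (h1.symm.trans h2)

/-- Take a nearly optimal family for `y`, cut at all its end points, and use the block sums of `y`
divided by `‖y‖` as coefficients. Merging coordinates into blocks does not increase the James norm.
-/
theorem exists_mem_stepDual_lt (y : JamesSpace) {u : ℝ} (hu : u < ‖y‖) :
    ∃ f ∈ stepDual, u < f y := by
  classical
  have hypos : 0 < ‖y‖ ∨ ‖y‖ = 0 := (norm_nonneg y).lt_or_eq.imp_right Eq.symm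
  rcases hypos with hy | hy
  swap
  · exact ⟨0, ⟨by simp, 0, by simp, fun _ => false, fun n => by simp [coe_zero]⟩,
      by simpa [hy] using hu⟩
  -- The family sum will be divided by `‖y‖`, so it has to exceed `u‖y‖`; the maximum with zero
  -- keeps the radicand nonnegative.
  have hlt : √(max u 0 * ‖y‖) < ‖y‖ := by
    rw [Real.sqrt_lt' hy]
    nlinarith [max_lt hu hy]
  obtain ⟨P, hP⟩ := exists_lt_of_lt_ciSup hlt
  have hP2 : max u 0 * ‖y‖ < ∑ K ∈ P.1, (∑ k ∈ K, y k) ^ 2 := by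
    rw [← familyNorm_sq]
    exact (Real.sqrt_lt (by positivity) (familyNorm_nonneg _ _)).mp hP
  obtain ⟨N, hN⟩ : ∃ N, ∀ K ∈ P.1, ∀ k ∈ K, k < N :=
    ⟨(P.1.biUnion id).sup Nat.succ, fun K hK k hk =>
      Finset.le_sup (f := Nat.succ) (Finset.mem_biUnion.mpr ⟨K, hK, hk⟩)⟩
  -- The extra cut after `N` puts everything beyond `N` into blocks with empty sums, where the
  -- coefficients must vanish.
  let T : ℕ → Bool := fun t => decide (t = N ∨ ∃ K ∈ P.1, ¬ (t ∈ K ↔ t + 1 ∈ K))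
  have hT : ∀ t, T t = true ↔ (t = N ∨ ∃ K ∈ P.1, ¬ (t ∈ K ↔ t + 1 ∈ K)) := fun t => by
    simp [T]
  obtain ⟨j, hj⟩ : ∃ j, j = blockIndex T := ⟨_, rfl⟩
  have hjm : Monotone j := hj ▸ blockIndex_mono T
  have hjs : ∀ n, T n = true → j (n + 1) = j n + 1 := fun n h => by
    rw [hj, blockIndex_succ, if_pos h]
  have hjs' : ∀ n, ¬ T n = true → j (n + 1) = j n := fun n h => by
    rw [hj, blockIndex_succ, if_neg h, add_zero]
  let blk : ℕ → Finset ℕ := fun i => {n ∈ Finset.range (N + 1) | j n = i}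
  have hblk : ∀ i n, n ∈ blk i ↔ n ≤ N ∧ j n = i := fun i n => by
    simp [blk]
  have hord : ∀ A : Set ℕ, A.OrdConnected → (j ⁻¹' A).OrdConnected := fun A hA =>
    hA.preimage_mono hjm
  -- the values on the blocks
  obtain ⟨β, hβ, hβ1⟩ := y.exists_norm_le (fun i => ∑ n ∈ blk i, y n)
    (fun K => {n ∈ Finset.range (N + 1) | j n ∈ K})
    (fun K hK => ordConnected_filter (by simpa using Set.ordConnected_Iio) _ (hord K hK))
    (fun K L _ _ h => Finset.disjoint_filter.mpr fun n _ h1 h2 => Finset.disjoint_left.mp h h1 h2)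
    (fun K _ => by
      rw [← Finset.sum_fiberwise_of_maps_to (s := {n ∈ Finset.range (N + 1) | j n ∈ K}) (t := K)
        (g := j) fun n hn => (Finset.mem_filter.mp hn).2]
      refine Finset.sum_congr rfl fun i hi => Finset.sum_congr ?_ fun _ _ => rfl
      ext n
      simp only [blk, Finset.mem_filter, and_assoc]
      exact and_congr_right fun _ => ⟨fun h => ⟨h ▸ hi, h⟩, fun h => h.2⟩)
  set α : JamesSpace := ‖y‖⁻¹ • β with hα
  have hα1 : ‖α‖ ≤ 1 := by
    rw [hα, norm_smul, norm_inv, norm_norm]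
    exact (mul_le_mul_of_nonneg_left hβ1 (by positivity)).trans (by rw [inv_mul_cancel₀ hy.ne'])
  have hαi : ∀ i, α i = ‖y‖⁻¹ * ∑ n ∈ blk i, y n := fun i => by
    rw [hα, coe_smul, Pi.smul_apply, hβ, smul_eq_mul]
  let f : StrongDual ℝ JamesSpace := ∑ n ∈ Finset.range (N + 1), α (j n) • coord n
  have hf : ∀ z : JamesSpace, f z = ∑ n ∈ Finset.range (N + 1), α (j n) * z n := fun z => by
    simp [f, coord_apply]
  have hfn : ‖f‖ ≤ 1 := by
    refine f.opNorm_le_bound zero_le_one fun z => ?_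
    rw [hf, Real.norm_eq_abs]
    exact (mul_sum_coord_le j hjm _).trans
      (mul_le_mul_of_nonneg_right hα1 (norm_nonneg z))
  refine ⟨f, ⟨hfn, α, hα1, T, fun n => ?_⟩, ?_⟩
  · rw [hf]
    simp only [single_apply, mul_ite, mul_one, mul_zero]
    rw [Finset.sum_ite_eq', ← hj]
    split_ifs with h
    · rfl
    · have hn : N + 1 ≤ n := by simpa using h
      rw [hαi, Finset.sum_eq_zero, mul_zero]
      intro k hk
      rw [hblk] at hk
      have h1 := hjs N ((hT N).mpr (Or.inl rfl))
      have h2 := hjm hn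
      have h3 := hjm hk.1
      omega
  · have hfy : f y = ‖y‖⁻¹ * ∑ i ∈ (Finset.range (N + 1)).image j, (∑ n ∈ blk i, y n) ^ 2 := by
      rw [hf, Finset.mul_sum, ← Finset.sum_fiberwise_of_maps_to (s := Finset.range (N + 1))
        (t := (Finset.range (N + 1)).image j) (g := j) fun n hn => Finset.mem_image_of_mem j hn]
      refine Finset.sum_congr rfl fun i _ => ?_
      rw [sq, ← mul_assoc, ← hαi, Finset.mul_sum]
      exact Finset.sum_congr rfl fun n hn => by rw [(Finset.mem_filter.mp hn).2]
    -- every interval of the family is a block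
    have hstep : ∀ K ∈ P.1, ∀ a ∈ K, ∀ b, a ≤ b → (b ∈ K ↔ b ≤ N ∧ j b = j a) := by
      intro K hK a ha b hab
      induction b, hab using Nat.le_induction with
      | base => simp [ha, (hN K hK a ha).le]
      | succ b hab ih =>
        by_cases hb : b ∈ K
        · have hb' := ih.mp hb
          constructor
          · intro hb1
            have hTb : ¬ T b = true := by
              rw [hT]
              rintro (rfl | ⟨L, hL, hLb⟩)
              · exact absurd (hN K hK _ hb) (lt_irrefl _)
              · by_cases hLK : L = K
                · exact hLb (by simp [hLK, hb, hb1])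
                · have hd := Finset.disjoint_left.mp (P.2.2 hL hK hLK)
                  exact hLb ⟨fun h => absurd hb (hd h), fun h => absurd hb1 (hd h)⟩
            exact ⟨(hN K hK _ hb1).le, by rw [hjs' b hTb, hb'.2]⟩
          · rintro ⟨-, h⟩
            by_contra hb1
            rw [hjs b ((hT b).mpr (Or.inr ⟨K, hK, by simp [hb, hb1]⟩))] at h
            omega
        · have h1 : b + 1 ∉ K := fun h => hb ((P.2.1 K hK).out ha h ⟨hab, by omega⟩)
          refine ⟨fun h => absurd h h1, fun ⟨h, h'⟩ => absurd (ih.mpr ⟨by omega, ?_⟩) hb⟩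
          exact le_antisymm (h' ▸ hjm (by omega)) (hjm hab)
    have hstep' : ∀ K ∈ P.1, ∀ a ∈ K, ∀ b < a, b ∉ K → j b ≠ j a := by
      intro K hK a ha b hba hb h
      induction hba' : a - b generalizing b with
      | zero => omega
      | succ m ih =>
        by_cases hb1 : b + 1 ∈ K
        · have h1 := hjs b ((hT b).mpr (Or.inr ⟨K, hK, by simp [hb, hb1]⟩))
          have h2 := hjm (show b + 1 ≤ a by omega)
          omega
        · have hne : b + 1 ≠ a := fun h => hb1 (h ▸ ha)
          refine ih (b + 1) (by omega) hb1 ?_ (by omega)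
          exact le_antisymm (hjm (by omega)) (h ▸ hjm (by omega))
    have hKblk : ∀ K ∈ P.1, ∀ a ∈ K, K = blk (j a) := by
      intro K hK a ha
      ext b
      rw [hblk]
      rcases le_or_gt a b with hab | hba
      · exact hstep K hK a ha b hab
      · constructor
        · intro hb
          exact ⟨(hN K hK b hb).le, (((hstep K hK b hb a hba.le).mp ha).2).symm⟩
        · rintro ⟨-, h⟩
          by_contra hb
          exact hstep' K hK a ha b hba hb h
    have hsum : ∑ K ∈ P.1, (∑ k ∈ K, y k) ^ 2 ≤
        ∑ i ∈ (Finset.range (N + 1)).image j, (∑ n ∈ blk i, y n) ^ 2 := by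
      have hle : ∑ K ∈ P.1.filter (·.Nonempty), (∑ k ∈ K, y k) ^ 2 ≤
          ∑ K ∈ ((Finset.range (N + 1)).image j).image blk, (∑ k ∈ K, y k) ^ 2 := by
        refine Finset.sum_le_sum_of_subset_of_nonneg ?_ fun _ _ _ => sq_nonneg _
        intro K hK
        obtain ⟨hK, a, ha⟩ := Finset.mem_filter.mp hK
        rw [hKblk K hK a ha]
        refine Finset.mem_image_of_mem _ (Finset.mem_image_of_mem _ ?_)
        have := hN K hK a ha
        simp only [Finset.mem_range]
        omega
      rw [Finset.sum_image] at hle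
      · refine le_trans (le_of_eq ?_) hle
        rw [Finset.sum_filter]
        refine Finset.sum_congr rfl fun K _ => ?_
        split_ifs with h
        · rfl
        · simp [Finset.not_nonempty_iff_eq_empty.mp h]
      · intro i hi k hk h
        obtain ⟨n, hn, rfl⟩ := Finset.mem_image.mp hi
        have hmem : n ∈ blk (j n) := (hblk _ _).mpr ⟨by simpa [Nat.lt_succ_iff] using hn, rfl⟩
        exact ((hblk _ _).mp (h ▸ hmem : n ∈ blk k)).2
    rw [hfy, inv_mul_eq_div, lt_div_iff₀ hy]
    exact ((mul_le_mul_of_nonneg_right (le_max_left u 0) hy.le).trans_lt hP2).trans_le hsum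

/-- The extreme points of the unit ball of `J*` are step functionals. -/
theorem mem_stepDual_of_mem_extremePoints {xs : StrongDual ℝ JamesSpace}
    (hxs : xs ∈ Set.extremePoints ℝ (Metric.closedBall (0 : StrongDual ℝ JamesSpace) 1)) :
    xs ∈ stepDual := by
  have : LocallyConvexSpace ℝ (WeakDual ℝ JamesSpace) :=
    inferInstanceAs (LocallyConvexSpace ℝ (WeakBilin (topDualPairing ℝ JamesSpace)))
  have hconv : Convex ℝ
      (WeakDual.toStrongDual ⁻¹' Metric.closedBall 0 1 : Set (WeakDual ℝ JamesSpace)) :=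
    (convex_closedBall (0 : StrongDual ℝ JamesSpace) 1).linear_preimage
      WeakDual.toStrongDual.toLinearMap
  have h := mem_of_mem_extremePoints_of_forall_le
    (B := (WeakDual.toStrongDual ⁻¹' Metric.closedBall 0 1 : Set (WeakDual ℝ JamesSpace)))
    (D := WeakDual.toStrongDual ⁻¹' stepDual) (x := StrongDual.toWeakDual xs)
    (WeakDual.isCompact_closedBall 0 1)
    hconv
    isCompact_stepDual (fun f hf => by simpa using hf.1)
    ⟨hxs.1, fun f hf g hg hfg => ?_⟩ fun φ u hφ => ?_
  · exact h
  · obtain ⟨a, b, ha, hb, hab, h⟩ := hfg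
    have h' := congrArg WeakDual.toStrongDual h
    rw [map_add, map_smul, map_smul] at h'
    exact WeakDual.toStrongDual.injective (hxs.2 hf hg ⟨a, b, ha, hb, hab, h'⟩)
  -- Weak* continuous functionals are evaluations at points `y`, and `stepDual` norms every `y`;
  -- hence no such functional separates `xs` from it.
  · obtain ⟨y, rfl⟩ := LinearMap.dualEmbedding_surjective _ φ
    change xs y ≤ u
    change ∀ d : StrongDual ℝ JamesSpace, d ∈ stepDual → d y ≤ u at hφ
    have h1 : ‖y‖ ≤ u := by
      by_contra! hlt
      obtain ⟨f, hf, hfu⟩ := exists_mem_stepDual_lt y hlt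
      exact absurd (hφ f hf) (not_le.mpr hfu)
    have h2 := xs.le_opNorm y
    have h3 : ‖xs‖ ≤ 1 := by simpa using hxs.1
    have h4 := norm_nonneg y
    rw [Real.norm_eq_abs] at h2
    nlinarith [le_abs_self (xs y)]

end JamesSpace

/-! ### Series of interval functionals -/

namespace NatInterval

open JamesSpace

theorem functional_eq_of_unique (I : NatInterval) (x : JamesSpace) (m : ℕ) (hm : m ∈ I.carrier)
    (h : ∀ n ∈ I.carrier, n ≠ m → x n = 0) : I.functional x = x m := by
  refine tendsto_nhds_unique (I.tendsto_sum x) (tendsto_const_nhds.congr' ?_)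
  filter_upwards [eventually_gt_atTop m] with N hN
  refine (Finset.sum_eq_single_of_mem m ((I.mem_trunc _ _).mpr ⟨hN, hm⟩) fun n hn hnm => ?_).symm
  exact h n ((I.mem_trunc _ _).mp hn).2 hnm

theorem functional_eq_zero (I : NatInterval) (x : JamesSpace) (h : ∀ n ∈ I.carrier, x n = 0) :
    I.functional x = 0 := by
  refine tendsto_nhds_unique (I.tendsto_sum x) (tendsto_const_nhds.congr fun N => ?_)
  exact (Finset.sum_eq_zero fun n hn => h n ((I.mem_trunc _ _).mp hn).2).symm

open Classical in
theorem functional_single (I : NatInterval) (n : ℕ) :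
    I.functional (single n) = if n ∈ I.carrier then 1 else 0 := by
  split_ifs with h
  · rw [I.functional_eq_of_unique _ n h fun k _ hk => by rw [single_apply, if_neg hk],
      single_apply, if_pos rfl]
  · exact I.functional_eq_zero _ fun k hk => by
      rw [single_apply, if_neg]; rintro rfl; exact h hk

/-- Cauchy–Schwarz: the sums of `x` over disjoint intervals have ℓ²-norm at most `‖x‖`. -/
theorem norm_sum_smul_functional_le {ι : Type*} (s : Finset ι) (α : ι → ℝ) (I : ι → NatInterval)
    (hI : Pairwise fun i j => Disjoint (I i).carrier (I j).carrier) :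
    ‖∑ i ∈ s, α i • (I i).functional‖ ≤ √(∑ i ∈ s, α i ^ 2) := by
  refine ContinuousLinearMap.opNorm_le_bound _ (Real.sqrt_nonneg _) fun x => ?_
  rw [_root_.sum_apply, Real.norm_eq_abs]
  have h := sqrt_sum_le_norm s I (fun i _ j _ hij => hI hij) x
  refine le_trans ?_ (mul_le_mul_of_nonneg_left h (Real.sqrt_nonneg _))
  rw [← Real.sqrt_mul (Finset.sum_nonneg fun i _ => sq_nonneg _)]
  refine Real.abs_le_sqrt ?_
  simp only [sq_abs]
  exact Finset.sum_mul_sq_le_sq_mul_sq s α fun i => (I i).sum x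

theorem summable_smul_functional {ι : Type*} {α : ι → ℝ} {I : ι → NatInterval}
    (hI : Pairwise fun i j => Disjoint (I i).carrier (I j).carrier)
    (hα : Summable fun i => α i ^ 2) : Summable fun i => α i • (I i).functional := by
  rw [summable_iff_vanishing_norm]
  intro ε hε
  obtain ⟨s, hs⟩ := summable_iff_vanishing_norm.mp hα (ε ^ 2) (by positivity)
  refine ⟨s, fun t ht => (norm_sum_smul_functional_le t α I hI).trans_lt ?_⟩
  rw [Real.sqrt_lt' hε]
  exact (le_abs_self _).trans_lt (hs t ht)

theorem norm_sq_le_of_hasSum {ι : Type*} {α : ι → ℝ} {I : ι → NatInterval}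
    (hI : Pairwise fun i j => Disjoint (I i).carrier (I j).carrier) {A : ℝ}
    (hA : HasSum (fun i => α i ^ 2) A) {f : StrongDual ℝ JamesSpace}
    (hf : HasSum (fun i => α i • (I i).functional) f) : ‖f‖ ^ 2 ≤ A := by
  refine le_of_tendsto (hf.norm.pow 2) (Eventually.of_forall fun s => ?_)
  have h := pow_le_pow_left₀ (norm_nonneg _) (norm_sum_smul_functional_le s α I hI) 2
  rw [Real.sq_sqrt (Finset.sum_nonneg fun i _ => sq_nonneg _)] at h
  exact h.trans (sum_le_hasSum s (fun i _ => sq_nonneg _) hA)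

theorem hasSum_apply_single_of_mem {ι : Type*} {α : ι → ℝ} {I : ι → NatInterval}
    (hI : Pairwise fun i j => Disjoint (I i).carrier (I j).carrier)
    {f : StrongDual ℝ JamesSpace} (hf : HasSum (fun i => α i • (I i).functional) f)
    {i : ι} {n : ℕ} (hn : n ∈ (I i).carrier) : f (single n) = α i := by
  have h := (ContinuousLinearMap.apply ℝ ℝ (single n)).hasSum hf
  refine h.unique ?_
  convert hasSum_single i fun k hk => ?_ using 1
  · simp [functional_single, hn]
  · have : n ∉ (I k).carrier := fun h => Set.disjoint_left.mp (hI hk) h hn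
    simp [functional_single, this]

theorem hasSum_apply_single_of_notMem {ι : Type*} {α : ι → ℝ} {I : ι → NatInterval}
    {f : StrongDual ℝ JamesSpace} (hf : HasSum (fun i => α i • (I i).functional) f)
    {n : ℕ} (hn : ∀ i, n ∉ (I i).carrier) : f (single n) = 0 := by
  have h := (ContinuousLinearMap.apply ℝ ℝ (single n)).hasSum hf
  refine h.unique ?_
  convert hasSum_zero using 2 with i
  simp [functional_single, hn]

end NatInterval

theorem Successive.pairwise_disjoint {F : Set ℕ} {I : F → NatInterval} (hI : Successive I) :
    Pairwise fun i j => Disjoint (I i).carrier (I j).carrier := by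
  intro i j hij
  rw [Set.disjoint_left]
  intro n hi hj
  rcases lt_or_gt_of_ne hij with h | h
  · exact lt_irrefl n (hI i j h n hi n hj)
  · exact lt_irrefl n (hI j i h n hj n hi)

/-! ### Alternating signs, absence of gaps, and necessity -/

namespace JamesSpace

instance : Nontrivial (StrongDual ℝ JamesSpace) := ⟨⟨coord 0, 0, fun h => by
  have := congrArg (fun f : StrongDual ℝ JamesSpace => f (single 0)) h
  simp [coord_apply, single_apply] at this⟩⟩

/-- In a unit vector of `ℓ²` which lies in the unit ball of `J`, sums over intervals are
dominated by `ℓ²`-norms. -/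
theorem sum_sq_le_sum_sq {x : JamesSpace} (hx : ‖x‖ ≤ 1) (hs : HasSum (fun n => x n ^ 2) 1)
    (K : Finset ℕ) (hK : (K : Set ℕ).OrdConnected) : (∑ k ∈ K, x k) ^ 2 ≤ ∑ k ∈ K, x k ^ 2 := by
  classical
  have h : ∀ s : Finset ℕ, K ⊆ s →
      (∑ k ∈ K, x k) ^ 2 - ∑ k ∈ K, x k ^ 2 + ∑ k ∈ s, x k ^ 2 ≤ 1 := by
    intro s hKs
    -- Test the norm on `K` together with singletons outside `K`; as `s` grows, the singletons
    -- exhaust the ℓ²-mass `1` up to the part inside `K`.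
    have h1 := x.sum_sq_le_norm_sq (Finset.disjSum {()} (s \ K))
      (Sum.elim (fun _ => K) fun n => {n}) ?_ ?_
    · rw [Finset.sum_disjSum] at h1
      simp only [Sum.elim_inl, Sum.elim_inr, Finset.sum_singleton] at h1
      rw [← Finset.sum_sdiff hKs]
      nlinarith [norm_nonneg x]
    · rintro (_ | n) -
      · exact hK
      · simpa using Set.ordConnected_singleton
    · rintro (⟨⟩ | n) hn (⟨⟩ | m) hm hne <;>
        simp only [Finset.mem_coe, Finset.inl_mem_disjSum, Finset.inr_mem_disjSum,
          Finset.mem_sdiff] at hn hm <;>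
        simp only [Function.onFun, Sum.elim_inl, Sum.elim_inr]
      · exact absurd rfl hne
      · exact Finset.disjoint_singleton_right.mpr hm.2
      · exact Finset.disjoint_singleton_left.mpr hn.2
      · exact Finset.disjoint_singleton.mpr fun h => hne (by rw [h])
  have h2 : (∑ k ∈ K, x k) ^ 2 - ∑ k ∈ K, x k ^ 2 + 1 ≤ 1 :=
    le_of_tendsto (hs.const_add _) ((eventually_ge_atTop K).mono fun s hKs => h s hKs)
  linarith

/-- Consecutive nonzero terms of a unit vector of `ℓ²` in the unit ball of `J` have opposite
signs. -/
theorem mul_nonpos_of_consecutive {x : JamesSpace} (hx : ‖x‖ ≤ 1)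
    (hs : HasSum (fun n => x n ^ 2) 1) {a b : ℕ} (hab : a < b)
    (h0 : ∀ n, a < n → n < b → x n = 0) : x a * x b ≤ 0 := by
  have h := sum_sq_le_sum_sq hx hs (Finset.Icc a b) (by simpa using Set.ordConnected_Icc)
  have hsum : ∀ f : ℕ → ℝ, (∀ n, a < n → n < b → f n = 0) →
      ∑ k ∈ Finset.Icc a b, f k = f a + f b := by
    intro f hf
    rw [← Finset.sum_pair hab.ne]
    refine (Finset.sum_subset ?_ fun n hn hn' => ?_).symm
    · intro n hn
      simp only [Finset.mem_insert, Finset.mem_singleton] at hn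
      rw [Finset.mem_Icc]
      omega
    · simp only [Finset.mem_insert, Finset.mem_singleton, not_or, Finset.mem_Icc] at hn hn'
      exact hf n (by omega) (by omega)
  rw [hsum _ h0, hsum _ fun n h1 h2 => by rw [h0 n h1 h2]; simp] at h
  nlinarith

/-- The index starts at zero and grows by at most one per step, so no value is skipped. -/
theorem exists_blockIndex_eq (T : ℕ → Bool) {n i : ℕ} (hi : i ≤ blockIndex T n) :
    ∃ k, blockIndex T k = i := by
  induction n with
  | zero => exact ⟨0, by simp [blockIndex] at hi ⊢; exact hi.symm⟩
  | succ n ih =>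
    rcases hi.eq_or_lt with rfl | hlt
    · exact ⟨_, rfl⟩
    · refine ih ?_
      rw [blockIndex_succ] at hlt
      split_ifs at hlt <;> omega

end JamesSpace

open JamesSpace

/-- The intervals representing an extreme point of the unit ball of `J*` leave no gaps. -/
theorem ordConnected_iUnion_of_mem_extremePoints {xs : StrongDual ℝ JamesSpace}
    (hxs : xs ∈ Set.extremePoints ℝ (Metric.closedBall (0 : StrongDual ℝ JamesSpace) 1))
    {F : Set ℕ} (hF : ∀ i ∈ F, ∀ k ≤ i, k ∈ F) {α : F → ℝ} {I : F → NatInterval}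
    (hI : Successive I) (hα0 : ∀ i, α i ≠ 0) (hα : HasSum (fun i => α i ^ 2) 1)
    (halt : ∀ (i : ℕ) (h : i ∈ F) (h' : i + 1 ∈ F), α ⟨i, h⟩ * α ⟨i + 1, h'⟩ ≤ 0)
    (hsum : HasSum (fun i => α i • (I i).functional) xs) :
    (⋃ i, (I i).carrier).OrdConnected := by
  classical
  refine ⟨fun a ha b hb n hn => ?_⟩
  by_contra hnU
  have hnI : ∀ i, n ∉ (I i).carrier := fun i h => hnU (Set.mem_iUnion.mpr ⟨i, h⟩)
  obtain ⟨⟨i₀, hi₀⟩, ha⟩ := Set.mem_iUnion.mp ha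
  obtain ⟨⟨k₀, hk₀⟩, hb⟩ := Set.mem_iUnion.mp hb
  have hside : ∀ i, (∃ u ∈ (I i).carrier, u < n) → ∀ u ∈ (I i).carrier, u < n := by
    rintro i ⟨u, hu, hun⟩ v hv
    by_contra! h
    exact hnI i ((I i).ordConnected.out hu hv ⟨hun.le, h⟩)
  have han : a < n := lt_of_le_of_ne hn.1 fun h => hnI _ (h ▸ ha)
  have hnb : n < b := lt_of_le_of_ne hn.2 fun h => hnI _ (h ▸ hb)
  -- two consecutive intervals on both sides of the gap
  obtain ⟨i, hi, hi1, hlow, hhigh⟩ : ∃ (i : ℕ) (hi : i ∈ F) (hi1 : i + 1 ∈ F),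
      (∀ u ∈ (I ⟨i, hi⟩).carrier, u < n) ∧ ∀ v ∈ (I ⟨i + 1, hi1⟩).carrier, n < v := by
    -- The greatest index with `p` is that of the last interval before `n`; the next interval must
    -- lie beyond `n`.
    let p : ℕ → Prop := fun i => ∃ hi : i ∈ F, ∀ u ∈ (I ⟨i, hi⟩).carrier, u < n
    have hp0 : p i₀ := ⟨hi₀, hside _ ⟨a, ha, han⟩⟩
    have hpk : ∀ i, p i → i < k₀ := by
      rintro i ⟨hi, h⟩
      by_contra! hle
      rcases hle.eq_or_lt with rfl | hlt
      · exact absurd (h b hb) (by omega)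
      · obtain ⟨u, hu⟩ := (I ⟨i, hi⟩).nonempty
        have h1 := hI ⟨k₀, hk₀⟩ ⟨i, hi⟩ hlt b hb u hu
        have h2 := h u hu
        omega
    have hmem := Nat.findGreatest_spec (P := p) (hpk i₀ hp0).le hp0
    set i := Nat.findGreatest p k₀
    obtain ⟨hi, hlow⟩ := id hmem
    have hlt := hpk i hmem
    refine ⟨i, hi, hF k₀ hk₀ _ hlt, hlow, fun v hv => ?_⟩
    by_contra! hvn
    have hvn' : v < n := lt_of_le_of_ne hvn fun h => hnI _ (h ▸ hv)
    have h3 := Nat.le_findGreatest (P := p) (show i + 1 ≤ k₀ from hlt)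
      ⟨hF k₀ hk₀ _ hlt, hside _ ⟨v, hv, hvn'⟩⟩
    have h4 : i + 1 ≤ i := h3
    omega
  set A := (I ⟨i, hi⟩).carrier with hA
  set B := (I ⟨i + 1, hi1⟩).carrier with hB
  have hAB : ∀ u ∈ A, ∀ v ∈ B, u < v := hI ⟨i, hi⟩ ⟨i + 1, hi1⟩ (Nat.lt_succ_self i)
  have hmid : ∀ l : F, l ≠ ⟨i, hi⟩ → l ≠ ⟨i + 1, hi1⟩ → ∀ t ∈ (I l).carrier,
      (∀ u ∈ A, t < u) ∨ ∀ v ∈ B, v < t := by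
    intro l h1 h2 t ht
    rcases lt_or_gt_of_ne h1 with h | h
    · exact Or.inl fun u hu => hI l _ h t ht u hu
    · refine Or.inr fun v hv => hI _ l ?_ v hv t ht
      have h3 : i < l.1 := h
      have h4 : l.1 ≠ i + 1 := fun h => h2 (Subtype.ext h)
      exact (show i + 1 < l.1 by omega)
  -- `J₁` is `A` together with the gap, and `J₂` below is the gap together with `B`.
  let J₁ : NatInterval := ⟨{t | (∃ u ∈ A, u ≤ t) ∧ ∀ v ∈ B, t < v}, by
      obtain ⟨u, hu⟩ := (I ⟨i, hi⟩).nonempty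
      exact ⟨u, ⟨u, hu, le_rfl⟩, hAB u hu⟩, by
      refine ⟨?_⟩
      rintro s ⟨⟨u, hu, hus⟩, -⟩ w ⟨-, hw⟩ t ht
      exact ⟨⟨u, hu, hus.trans ht.1⟩, fun v hv => ht.2.trans_lt (hw v hv)⟩⟩
  let J₂ : NatInterval := ⟨{t | (∀ u ∈ A, u < t) ∧ ∃ v ∈ B, t ≤ v}, by
      obtain ⟨v, hv⟩ := (I ⟨i + 1, hi1⟩).nonempty
      exact ⟨v, fun u hu => hAB u hu v hv, ⟨v, hv, le_rfl⟩⟩, by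
      refine ⟨?_⟩
      rintro s ⟨hs, -⟩ w ⟨-, ⟨v, hv, hwv⟩⟩ t ht
      exact ⟨fun u hu => (hs u hu).trans_le ht.1, v, hv, ht.2.trans hwv⟩⟩
  have hAne := (I ⟨i, hi⟩).nonempty
  have hBne := (I ⟨i + 1, hi1⟩).nonempty
  have hupd : ∀ (k : F) (L : NatInterval),
      (∀ l, l ≠ k → Disjoint (I l).carrier L.carrier) →
      Pairwise fun l l' => Disjoint (Function.update I k L l).carrier
        (Function.update I k L l').carrier := by
    intro k L h l l' hl
    by_cases h1 : l = k
    · subst h1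
      rw [Function.update_self, Function.update_of_ne hl.symm]
      exact (h l' hl.symm).symm
    · by_cases h2 : l' = k
      · subst h2
        rw [Function.update_self, Function.update_of_ne h1]
        exact h l h1
      · rw [Function.update_of_ne h1, Function.update_of_ne h2]
        exact hI.pairwise_disjoint hl
  -- Replacing one interval by another that is still disjoint from the rest keeps the coefficients,
  -- whose ℓ²-norm is one, so the norm stays at most one.
  have hball : ∀ (k : F) (L : NatInterval),
      (∀ l, l ≠ k → Disjoint (I l).carrier L.carrier) →
      xs + α k • (L.functional - (I k).functional) ∈
        Metric.closedBall (0 : StrongDual ℝ JamesSpace) 1 := by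
    intro k L h
    have h1 := hsum.update k (α k • L.functional)
    have h2 : Function.update (fun l => α l • (I l).functional) k (α k • L.functional) =
        fun l => α l • (Function.update I k L l).functional := by
      funext l
      by_cases hl : l = k
      · subst hl
        rw [Function.update_self, Function.update_self]
      · rw [Function.update_of_ne hl, Function.update_of_ne hl]
    rw [h2] at h1
    have h3 := NatInterval.norm_sq_le_of_hasSum (hupd k L h) hα h1
    rw [mem_closedBall_zero_iff]
    have h4 : xs + α k • (L.functional - (I k).functional) =
        α k • L.functional - α k • (I k).functional + xs := by
      rw [smul_sub]
      abel
    rw [h4]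
    exact abs_le_of_sq_le_sq' (by simpa using h3) zero_le_one |>.2
  have hb1 := hball ⟨i, hi⟩ J₁ fun l hl => by
    rw [Set.disjoint_left]
    rintro t ht ⟨⟨u, hu, hut⟩, htB⟩
    by_cases hl2 : l = ⟨i + 1, hi1⟩
    · subst hl2
      exact lt_irrefl t (htB t ht)
    · rcases hmid l hl hl2 t ht with h | h
      · exact absurd (h u hu) (by omega)
      · obtain ⟨v, hv⟩ := hBne
        have := h v hv
        have := htB v hv
        omega
  have hb2 := hball ⟨i + 1, hi1⟩ J₂ fun l hl => by
    rw [Set.disjoint_left]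
    rintro t ht ⟨htA, ⟨v, hv, hvt⟩⟩
    by_cases hl2 : l = ⟨i, hi⟩
    · subst hl2
      exact lt_irrefl t (htA t ht)
    · rcases hmid l hl2 hl t ht with h | h
      · obtain ⟨u, hu⟩ := hAne
        have := h u hu
        have := htA u hu
        omega
      · exact absurd (h v hv) (by omega)
  have hG : J₁.functional - (I ⟨i, hi⟩).functional =
      J₂.functional - (I ⟨i + 1, hi1⟩).functional := by
    refine dual_ext fun t => ?_
    simp only [_root_.sub_apply, NatInterval.functional_single, ← hA, ← hB]
    have e1 : t ∈ J₁.carrier ↔ (∃ u ∈ A, u ≤ t) ∧ ∀ v ∈ B, t < v := Iff.rfl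
    have e2 : t ∈ J₂.carrier ↔ (∀ u ∈ A, u < t) ∧ ∃ v ∈ B, t ≤ v := Iff.rfl
    by_cases htA : t ∈ A
    · have f1 : t ∈ J₁.carrier := e1.mpr ⟨⟨t, htA, le_rfl⟩, hAB t htA⟩
      have f2 : t ∉ J₂.carrier := fun h => lt_irrefl t ((e2.mp h).1 t htA)
      have f3 : t ∉ B := fun h => lt_irrefl t (hAB t htA t h)
      simp [f1, f2, f3, htA]
    · by_cases htB : t ∈ B
      · have f1 : t ∉ J₁.carrier := fun h => lt_irrefl t ((e1.mp h).2 t htB)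
        have f2 : t ∈ J₂.carrier := e2.mpr ⟨fun u hu => hAB u hu t htB, t, htB, le_rfl⟩
        simp [f1, f2, htA, htB]
      · have f : t ∈ J₁.carrier ↔ t ∈ J₂.carrier := by
          rw [e1, e2]
          constructor
          · rintro ⟨⟨u, hu, hut⟩, h⟩
            refine ⟨fun w hw => ?_, ?_⟩
            · by_contra! htw
              exact htA ((I ⟨i, hi⟩).ordConnected.out hu hw ⟨hut, htw⟩)
            · obtain ⟨v, hv⟩ := hBne
              exact ⟨v, hv, (h v hv).le⟩
          · rintro ⟨h, ⟨v, hv, htv⟩⟩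
            refine ⟨?_, fun w hw => ?_⟩
            · obtain ⟨u, hu⟩ := hAne
              exact ⟨u, hu, (h u hu).le⟩
            · by_contra! hwt
              exact htB ((I ⟨i + 1, hi1⟩).ordConnected.out hw hv ⟨hwt, htv⟩)
        simp [f, htA, htB]
  rw [← hG] at hb2
  set G := J₁.functional - (I ⟨i, hi⟩).functional
  have hGn : G (single n) = 1 := by
    have f1 : n ∈ J₁.carrier := by
      obtain ⟨u, hu⟩ := hAne
      exact ⟨⟨u, hu, (hlow u hu).le⟩, hhigh⟩
    have f2 : n ∉ (I ⟨i, hi⟩).carrier := hnI _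
    simp [G, NatInterval.functional_single, f1, f2]
  have hne := (halt i hi hi1).lt_of_ne (mul_ne_zero (hα0 _) (hα0 _))
  set c := α ⟨i, hi⟩
  set d := α ⟨i + 1, hi1⟩
  have hcd : c - d ≠ 0 := fun h => by
    have : c = d := sub_eq_zero.mp h
    rw [this] at hne
    nlinarith
  have hpos : 0 < -d / (c - d) ∧ 0 < c / (c - d) := by
    have h1 : 0 < (c - d) ^ 2 := by positivity
    have e1 : -d / (c - d) = (-d * (c - d)) / (c - d) ^ 2 := by field_simp
    have e2 : c / (c - d) = (c * (c - d)) / (c - d) ^ 2 := by field_simp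
    rw [e1, e2]
    exact ⟨div_pos (by nlinarith) h1, div_pos (by nlinarith) h1⟩
  -- As `c` and `d` have opposite signs, zero is the strict convex combination of them with weights
  -- `-d/(c - d)` and `c/(c - d)`; so `xs` lies strictly between `xs + cG` and `xs + dG`.
  have hfin := hxs.2 hb1 hb2 ⟨-d / (c - d), c / (c - d), hpos.1, hpos.2, by field_simp; ring, by
    have e : -d / (c - d) * c + c / (c - d) * d = 0 := by field_simp; ring
    have e' : -d / (c - d) + c / (c - d) = 1 := by field_simp; ring
    calc (-d / (c - d)) • (xs + c • G) + (c / (c - d)) • (xs + d • G)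
        = (-d / (c - d) + c / (c - d)) • xs + (-d / (c - d) * c + c / (c - d) * d) • G := by module
      _ = xs := by rw [e, e', one_smul, zero_smul, add_zero]⟩
  have h5 := congrArg (fun f : StrongDual ℝ JamesSpace => f (single n)) hfin
  simp [hGn] at h5
  exact hα0 _ h5

/-- A step functional is already a sum over blocks. Keeping only nonempty blocks with nonzero
values, in increasing order, gives the representation; extremality forces the ℓ²-norm one and the
absence of gaps. -/
theorem exists_representation_of_mem_extremePoints {xs : StrongDual ℝ JamesSpace}
    (hxs : xs ∈ Set.extremePoints ℝ (Metric.closedBall (0 : StrongDual ℝ JamesSpace) 1)) :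
    ∃ (F : Set ℕ) (α : F → ℝ) (I : F → NatInterval),
      IsIndexSet F ∧ Successive I ∧ (∀ i, α i ≠ 0) ∧
      HasSum (fun i => α i • (I i).functional) xs ∧
      (∃ x : JamesSpace, (∀ i : F, x i = α i) ∧ (∀ n, n ∉ F → x n = 0) ∧
        x ∈ Set.extremePoints ℝ (Metric.closedBall (0 : JamesSpace) 1)) ∧
      (⋃ i, (I i).carrier).OrdConnected := by
  classical
  obtain ⟨-, α, hα, T, hT⟩ := mem_stepDual_of_mem_extremePoints hxs
  have hxs1 : ‖xs‖ = 1 := by simpa using extremePoints_closedBall_subset_sphere hxs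
  set j := blockIndex T with hj
  have hjm : Monotone j := blockIndex_mono T
  let p : ℕ → Prop := fun i => α i ≠ 0 ∧ ∃ n, j n = i
  -- The indices at which `Nat.nth p` really enumerates `p`; beyond them it returns the default
  -- value zero.
  let F : Set ℕ := {i | ∀ hf : (Set.ofPred p).Finite, i < hf.toFinset.card}
  let m : ℕ → ℕ := Nat.nth p
  have hpm : ∀ i ∈ F, p (m i) := fun i hi => Nat.nth_mem i hi
  have hmsurj : ∀ t, p t → ∃ i ∈ F, m i = t := fun t ht => Nat.exists_lt_card_nth_eq ht
  have hFlow : ∀ i ∈ F, ∀ k ≤ i, k ∈ F := fun i hi k hk hf => hk.trans_lt (hi hf)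
  have hmlt : ∀ a b, b ∈ F → a < b → m a < m b := fun a b hb hab => Nat.nth_lt_nth' hab hb
  have hmle : ∀ a b, a ∈ F → m a ≤ m b → a ≤ b := fun a b ha h => by
    by_contra! hlt
    exact absurd (hmlt b a ha hlt) (not_lt.mpr h)
  have hmmono : ∀ a b, b ∈ F → a ≤ b → m a ≤ m b := fun a b hb h => by
    rcases h.eq_or_lt with rfl | h
    · exact le_rfl
    · exact (hmlt a b hb h).le
  have h0F : 0 ∈ F := by
    obtain ⟨n, hn⟩ : ∃ n, xs (single n) ≠ 0 := by
      by_contra! h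
      have : xs = 0 := dual_ext h
      rw [this, norm_zero] at hxs1
      exact zero_ne_one hxs1
    obtain ⟨i, hi, -⟩ := hmsurj (j n) ⟨by rwa [← hT], n, rfl⟩
    exact hFlow i hi 0 (Nat.zero_le _)
  have hFidx : IsIndexSet F := by
    by_cases hf : (Set.ofPred p).Finite
    · refine Or.inr ⟨hf.toFinset.card, h0F hf, ?_⟩
      ext i
      exact ⟨fun h => h hf, fun h _ => h⟩
    · exact Or.inl (Set.eq_univ_of_forall fun i h => absurd h hf)
  let I : F → NatInterval := fun i => ⟨{n | j n = m i}, (hpm i i.2).2,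
    (Set.ordConnected_singleton (a := m i)).preimage_mono hjm⟩
  have hI : Successive I := by
    intro i k hik a (ha : j a = m i) b (hb : j b = m k)
    by_contra! hba
    have h1 := hjm hba
    rw [ha, hb] at h1
    exact absurd (hmlt i k k.2 hik) (not_lt.mpr h1)
  -- the coefficients without the zeros
  let hull : Finset ℕ → Set ℕ := fun K => {t | ∃ a ∈ K, ∃ b ∈ K, a ∈ F ∧ b ∈ F ∧ m a ≤ t ∧ t ≤ m b}
  have hfin : ∀ K, (hull K).Finite := fun K =>
    (Finset.finite_toSet (Finset.range (K.sup m + 1))).subset fun t ⟨a, _, b, hb, _, _, _, h⟩ => by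
      have := Finset.le_sup (f := m) hb
      simp only [Finset.coe_range, Set.mem_Iio]
      omega
  obtain ⟨x, hx, hx1⟩ := α.exists_norm_le (fun i => if i ∈ F then α (m i) else 0)
    (fun K => (hfin K).toFinset)
    (fun K _ => by
      rw [Set.Finite.coe_toFinset]
      refine ⟨?_⟩
      rintro s ⟨a, ha, -, -, haF, -, has, -⟩ w ⟨-, -, b, hb, -, hbF, -, hwb⟩ t ht
      exact ⟨a, ha, b, hb, haF, hbF, has.trans ht.1, ht.2.trans hwb⟩)
    (fun K L hK hL hKL => by
      rw [Finset.disjoint_left]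
      intro t htK htL
      rw [Set.Finite.mem_toFinset] at htK htL
      obtain ⟨a, ha, b, hb, haF, hbF, hat, htb⟩ := htK
      obtain ⟨c, hc, d, hd, hcF, hdF, hct, htd⟩ := htL
      have h1 := hmle a d haF (hat.trans htd)
      have h2 := hmle c b hcF (hct.trans htb)
      rcases le_total a c with h | h
      · exact Finset.disjoint_left.mp hKL (hK.out ha hb ⟨h, h2⟩) hc
      · exact Finset.disjoint_left.mp hKL ha (hL.out hc hd ⟨h, h1⟩))
    (fun K hK => by
      have himg : ∑ t ∈ (K.filter (· ∈ F)).image m, α t = ∑ i ∈ K, if i ∈ F then α (m i) else 0 := by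
        rw [Finset.sum_image, Finset.sum_filter]
        intro a ha b hb hab
        have haF := (Finset.mem_filter.mp ha).2
        have hbF := (Finset.mem_filter.mp hb).2
        exact le_antisymm (hmle a b haF hab.le) (hmle b a hbF hab.ge)
      rw [← himg]
      refine Finset.sum_subset ?_ fun t ht ht' => ?_
      · intro t ht
        obtain ⟨a, ha, rfl⟩ := Finset.mem_image.mp ht
        obtain ⟨ha, haF⟩ := Finset.mem_filter.mp ha
        rw [Set.Finite.mem_toFinset]
        exact ⟨a, ha, a, ha, haF, haF, le_rfl, le_rfl⟩
      · rw [Set.Finite.mem_toFinset] at ht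
        obtain ⟨a, ha, b, hb, haF, hbF, hat, htb⟩ := ht
        -- The hull of the retained old indices adds only zero terms: a nonzero value below an
        -- occurring block index belongs to an occurring block, hence is enumerated by `m`.
        by_contra hαt
        obtain ⟨n, hn⟩ := (hpm b hbF).2
        obtain ⟨c, hcF, rfl⟩ := hmsurj t ⟨hαt, exists_blockIndex_eq T (n := n)
          (by rw [← hj, hn]; exact htb)⟩
        refine ht' (Finset.mem_image_of_mem m (Finset.mem_filter.mpr ⟨?_, hcF⟩))
        exact hK.out ha hb ⟨hmle a c haF hat, hmle c b hcF htb⟩)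
  have hx1 : ‖x‖ ≤ 1 := hx1.trans hα
  have hxF : ∀ i : F, x i = α (m i) := fun i => by
    rw [hx]
    exact if_pos i.2
  have hxF' : ∀ n, n ∉ F → x n = 0 := fun n hn => by
    rw [hx]
    exact if_neg hn
  have hsumF : ∀ A, HasSum (fun n => x n ^ 2) A → HasSum (fun i : F => α (m i) ^ 2) A := by
    intro A hA
    have h := (hasSum_subtype_iff_of_support_subset (f := fun n => x n ^ 2) (s := F)
      fun n hn => by
        by_contra hnF
        exact hn (by simp [hxF' n hnF])).mpr hA
    refine h.congr_fun fun i => ?_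
    simp [hxF]
  have hsq := hsumF _ x.summable_sq.hasSum
  have hsum : HasSum (fun i : F => α (m i) • (I i).functional) xs := by
    have h := (NatInterval.summable_smul_functional hI.pairwise_disjoint hsq.summable).hasSum
    convert h using 1
    refine dual_ext fun n => ?_
    rw [hT]
    by_cases hn : p (j n)
    · obtain ⟨i, hi, hin⟩ := hmsurj _ hn
      rw [NatInterval.hasSum_apply_single_of_mem hI.pairwise_disjoint h (i := ⟨i, hi⟩)
        (show j n = m i from hin.symm), hin]
    · rw [NatInterval.hasSum_apply_single_of_notMem h fun i (hi : j n = m i) =>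
        hn (hi ▸ hpm i i.2)]
      by_contra h0
      exact hn ⟨h0, n, rfl⟩
  -- `1 = ‖xs‖² ≤ ∑ x(n)² ≤ ‖x‖² ≤ 1`.
  have hone : ∑' n, x n ^ 2 = 1 := by
    have h1 := NatInterval.norm_sq_le_of_hasSum hI.pairwise_disjoint hsq hsum
    rw [hxs1] at h1
    have h2 := x.tsum_sq_le
    have h3 := norm_nonneg x
    nlinarith
  have hxsq : HasSum (fun n => x n ^ 2) 1 := hone ▸ x.summable_sq.hasSum
  refine ⟨F, fun i => α (m i), I, hFidx, hI, fun i => (hpm i i.2).1, hsum,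
    ⟨x, hxF, hxF', mem_extremePoints_of_hasSum_sq hx1 hxsq⟩, ?_⟩
  refine ordConnected_iUnion_of_mem_extremePoints hxs hFlow hI (fun i => (hpm i i.2).1)
    (hsumF 1 hxsq) (fun i hi hi1 => ?_) hsum
  have h := mul_nonpos_of_consecutive hx1 hxsq (Nat.lt_succ_self i) fun n h1 h2 => by omega
  rw [← hxF ⟨i, hi⟩, ← hxF ⟨i + 1, hi1⟩]
  exact h

/-! ### First-order estimates along alternating signs -/

namespace JamesSpace

/-- First-order estimate of a norm-one functional which attains its norm at `z`. -/
theorem apply_le_of_excess_le {z y : JamesSpace} (hz : ‖z‖ ≤ 1)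
    (hs : HasSum (fun n => z n ^ 2) 1) (hzy : ∀ n, 0 ≤ z n * y n) {S η : ℝ}
    (hS : HasSum (fun n => z n * y n) S) (hη : 0 ≤ η) (N : ℕ)
    (hK : ∀ K : Finset ℕ, (K : Set ℕ).OrdConnected →
      (∑ k ∈ K, z k) * ∑ k ∈ K, y k ≤ ∑ k ∈ K, z k * y k + if N ∈ K then η else 0)
    {g : StrongDual ℝ JamesSpace} (hg : ‖g‖ ≤ 1) (hgz : g z = 1) : g y ≤ S + η := by
  classical
  -- Expand the square on each interval; the pure `z` terms total at most one, and the error `η`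
  -- enters once because `N` lies in at most one interval of a family.
  have hnorm : ∀ t : ℝ, 0 ≤ t → ‖z + t • y‖ ^ 2 ≤ 1 + 2 * t * (S + η) + t ^ 2 * ‖y‖ ^ 2 := by
    intro t ht
    refine norm_sq_le_of_sum_sq_le _ fun P => ?_
    have h1 : ∀ K ∈ P.1, (∑ k ∈ K, (z + t • y : JamesSpace) k) ^ 2 ≤ ∑ k ∈ K, z k ^ 2 +
        2 * t * (∑ k ∈ K, z k * y k) + 2 * t * (if N ∈ K then η else 0) +
          t ^ 2 * (∑ k ∈ K, y k) ^ 2 := by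
      intro K hKP
      have e : ∑ k ∈ K, (z + t • y : JamesSpace) k = ∑ k ∈ K, z k + t * ∑ k ∈ K, y k := by
        rw [coe_add, coe_smul, Finset.mul_sum, ← Finset.sum_add_distrib]
        rfl
      rw [e]
      have h2 := sum_sq_le_sum_sq hz hs K (P.2.1 K hKP)
      have h3 := mul_le_mul_of_nonneg_left (hK K (P.2.1 K hKP)) ht
      nlinarith
    refine (Finset.sum_le_sum h1).trans ?_
    rw [Finset.sum_add_distrib, Finset.sum_add_distrib, Finset.sum_add_distrib, ← Finset.mul_sum,
      ← Finset.mul_sum, ← Finset.mul_sum]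
    have hdis : Set.PairwiseDisjoint (P.1 : Set (Finset ℕ)) id := P.2.2
    have h4 : ∑ K ∈ P.1, ∑ k ∈ K, z k ^ 2 ≤ 1 :=
      (Finset.sum_biUnion (f := fun k => z k ^ 2) (t := id) hdis).ge.trans
        (sum_le_hasSum _ (fun _ _ => sq_nonneg _) hs)
    have h5 : ∑ K ∈ P.1, ∑ k ∈ K, z k * y k ≤ S :=
      (Finset.sum_biUnion (f := fun k => z k * y k) (t := id) hdis).ge.trans
        (sum_le_hasSum _ (fun _ _ => hzy _) hS)
    have h6 : ∑ K ∈ P.1, (if N ∈ K then η else 0) ≤ η := by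
      rw [← Finset.sum_filter, Finset.sum_const, nsmul_eq_mul]
      refine mul_le_of_le_one_left hη ?_
      norm_cast
      rw [Finset.card_le_one]
      intro K hK L hL
      by_contra hne
      rw [Finset.mem_filter] at hK hL
      exact Finset.disjoint_left.mp (P.2.2 hK.1 hL.1 hne) hK.2 hL.2
    have h7 : ∑ K ∈ P.1, (∑ k ∈ K, y k) ^ 2 ≤ ‖y‖ ^ 2 := y.sum_sq_le_norm_sq _ id P.2.1 P.2.2
    have h8 := mul_le_mul_of_nonneg_left h5 ht
    have h9 := mul_le_mul_of_nonneg_left h6 ht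
    have h10 := mul_le_mul_of_nonneg_left h7 (sq_nonneg t)
    linarith
  by_contra! hlt
  set δ := g y - (S + η) with hδ
  have hδ0 : 0 < δ := by linarith
  -- Small enough for the second-order term `t²‖y‖²` to stay below the linear gain `2tδ`.
  set t := δ / (‖y‖ ^ 2 + 1) with ht
  have ht0 : 0 < t := by positivity
  have h1 := hnorm t ht0.le
  have h2 : g (z + t • y) ^ 2 ≤ ‖z + t • y‖ ^ 2 := by
    have h := g.le_of_opNorm_le hg (z + t • y)
    rw [one_mul, Real.norm_eq_abs] at h
    exact sq_le_sq.mpr (by rwa [abs_of_nonneg (norm_nonneg (z + t • y))])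
  rw [map_add, map_smul, hgz, smul_eq_mul] at h2
  have h3 : t * (‖y‖ ^ 2 + 1) = δ := by rw [ht]; field_simp
  have h4 : 2 * t * δ ≤ t ^ 2 * ‖y‖ ^ 2 := by nlinarith [sq_nonneg (t * g y)]
  nlinarith [mul_pos ht0 hδ0, sq_nonneg t]

/-- The values of `σ` are signs, and successive nonzero values are opposite. -/
def Alternating (σ : ℕ → ℝ) : Prop :=
  (∀ n, σ n = 0 ∨ |σ n| = 1) ∧
    ∀ a b, a < b → σ a ≠ 0 → σ b ≠ 0 → (∀ n, a < n → n < b → σ n = 0) → σ b = -σ a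

theorem Alternating.abs_sum_Ico_le {σ : ℕ → ℝ} (hσ : Alternating σ) (a b : ℕ) :
    |∑ n ∈ Finset.Ico a b, σ n| ≤ 1 := by
  rcases le_total b a with hab | hab
  · simp [Finset.Ico_eq_empty_of_le hab]
  -- Invariant: the running sum is zero or equals the last nonzero sign.
  have h : ((∀ n, a ≤ n → n < b → σ n = 0) ∧ ∑ n ∈ Finset.Ico a b, σ n = 0) ∨
      ∃ l, a ≤ l ∧ l < b ∧ σ l ≠ 0 ∧ (∀ n, l < n → n < b → σ n = 0) ∧
        (∑ n ∈ Finset.Ico a b, σ n = 0 ∨ ∑ n ∈ Finset.Ico a b, σ n = σ l) := by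
    induction b, hab using Nat.le_induction with
    | base => exact Or.inl ⟨fun n h1 h2 => by omega, by simp⟩
    | succ b hab ih =>
      rw [Finset.sum_Ico_succ_top hab]
      by_cases hb : σ b = 0
      · rw [hb, add_zero]
        rcases ih with ⟨h1, h2⟩ | ⟨l, h1, h2, h3, h4, h5⟩
        · refine Or.inl ⟨fun n hn hn' => ?_, h2⟩
          rcases (Nat.lt_succ_iff.mp hn').eq_or_lt with rfl | hlt
          · exact hb
          · exact h1 n hn hlt
        · refine Or.inr ⟨l, h1, by omega, h3, fun n hn hn' => ?_, h5⟩
          rcases (Nat.lt_succ_iff.mp hn').eq_or_lt with rfl | hlt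
          · exact hb
          · exact h4 n hn hlt
      · refine Or.inr ⟨b, hab, by omega, hb, fun n h1 h2 => by omega, ?_⟩
        rcases ih with ⟨h1, h2⟩ | ⟨l, h1, h2, h3, h4, h5⟩
        · exact Or.inr (by rw [h2, zero_add])
        · have h6 := hσ.2 l b h2 h3 hb h4
          rcases h5 with h5 | h5
          · exact Or.inr (by rw [h5, zero_add])
          · exact Or.inl (by rw [h5, h6, add_neg_cancel])
  rcases h with ⟨-, h⟩ | ⟨l, -, -, -, -, h | h⟩
  · simp [h]
  · simp [h]
  · rw [h]
    rcases hσ.1 l with h | h <;> simp [h]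

theorem eq_Ico_of_ordConnected {K : Finset ℕ} (hK : (K : Set ℕ).OrdConnected) :
    ∃ a b, K = Finset.Ico a b := by
  rcases K.eq_empty_or_nonempty with rfl | hne
  · exact ⟨0, 0, by simp⟩
  refine ⟨K.min' hne, K.max' hne + 1, ?_⟩
  ext n
  rw [Finset.mem_Ico]
  refine ⟨fun h => ⟨K.min'_le n h, Nat.lt_succ_of_le (K.le_max' n h)⟩, fun h => ?_⟩
  exact hK.out (K.min'_mem hne) (K.max'_mem hne) ⟨h.1, Nat.lt_succ_iff.mp h.2⟩

theorem Alternating.abs_sum_le {σ : ℕ → ℝ} (hσ : Alternating σ) {K : Finset ℕ}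
    (hK : (K : Set ℕ).OrdConnected) : |∑ n ∈ K, σ n| ≤ 1 := by
  obtain ⟨a, b, rfl⟩ := eq_Ico_of_ordConnected hK
  exact hσ.abs_sum_Ico_le a b

/-- The first `N` terms of a sequence. -/
noncomputable def ofRange (σ : ℕ → ℝ) (N : ℕ) : JamesSpace := ∑ n ∈ Finset.range N, σ n • single n

theorem ofRange_apply (σ : ℕ → ℝ) (N n : ℕ) : ofRange σ N n = if n < N then σ n else 0 := by
  rw [ofRange, coe_sum]
  simp only [coe_smul, Pi.smul_apply, single_apply, smul_eq_mul, mul_ite, mul_one, mul_zero]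
  simp

theorem sum_ofRange (σ : ℕ → ℝ) (N : ℕ) (K : Finset ℕ) :
    ∑ k ∈ K, ofRange σ N k = ∑ k ∈ K with k < N, σ k := by
  rw [Finset.sum_filter]
  exact Finset.sum_congr rfl fun k _ => ofRange_apply σ N k

theorem sum_mul_ofRange {z : JamesSpace} {σ : ℕ → ℝ} (hz : ∀ n, z n * σ n = |z n|) (N : ℕ)
    (K : Finset ℕ) : ∑ k ∈ K, z k * ofRange σ N k = ∑ k ∈ K with k < N, |z k| := by
  rw [Finset.sum_filter]
  refine Finset.sum_congr rfl fun k _ => ?_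
  rw [ofRange_apply]
  split_ifs
  · exact hz k
  · exact mul_zero _

/-- An interval meeting both sides of `N` contains `N`, so at most one interval of a disjoint family
pays for the tail. -/
theorem abs_sum_ge_le (z : JamesSpace) (N : ℕ) {K : Finset ℕ} (hK : (K : Set ℕ).OrdConnected)
    (hne : ∃ k ∈ K, k < N) :
    |∑ k ∈ K with ¬ k < N, z k| ≤ if N ∈ K then ‖high N z‖ else 0 := by
  split_ifs with h
  · have e : ∑ k ∈ K with ¬ k < N, z k = ∑ k ∈ K, high N z k := by
      simp only [sum_high, not_lt]
    rw [e]
    exact abs_sum_le_norm _ _ hK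
  · refine le_of_eq (abs_eq_zero.mpr (Finset.sum_eq_zero fun k hk => ?_))
    obtain ⟨hk, hkN⟩ := Finset.mem_filter.mp hk
    obtain ⟨l, hl, hlN⟩ := hne
    exact absurd (hK.out hl hk ⟨hlN.le, not_lt.mp hkN⟩) h

/-- Alternation gives `|∑ σ| ≤ 1` on every interval, so the product is at most `|∑ z|`. This
provides the excess hypothesis of `apply_le_of_excess_le` with `η = ‖high N z‖`. -/
theorem excess_ofRange_le {z : JamesSpace} {σ : ℕ → ℝ} (hσ : Alternating σ)
    (hz : ∀ n, z n * σ n = |z n|) (N : ℕ) (K : Finset ℕ) (hK : (K : Set ℕ).OrdConnected) :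
    (∑ k ∈ K, z k) * ∑ k ∈ K, ofRange σ N k ≤
      ∑ k ∈ K, z k * ofRange σ N k + if N ∈ K then ‖high N z‖ else 0 := by
  rw [sum_ofRange, sum_mul_ofRange hz]
  by_cases hne : ∃ k ∈ K, k < N
  · have h1 := abs_sum_ge_le z N hK hne
    have h2 := hσ.abs_sum_le (ordConnected_filter hK _ (ordConnected_lt N))
    have h3 : |∑ k ∈ K with k < N, z k| ≤ ∑ k ∈ K with k < N, |z k| :=
      Finset.abs_sum_le_sum_abs _ _
    rw [← Finset.sum_filter_add_sum_filter_not K (· < N) fun k => z k]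
    refine (le_abs_self _).trans ?_
    rw [abs_mul]
    refine (mul_le_of_le_one_right (abs_nonneg _) h2).trans ?_
    exact (abs_add_le _ _).trans (add_le_add h3 h1)
  · push Not at hne
    rw [Finset.filter_eq_empty_iff.mpr fun k hk => not_lt.mpr (hne k hk)]
    simp only [Finset.sum_empty, mul_zero, zero_add]
    split_ifs
    · exact norm_nonneg _
    · exact le_rfl

/-- Around a nonzero coordinate, cancellation in the sums over intervals is bounded below. -/
theorem exists_cancellation {z : JamesSpace} (hz : ‖z‖ ≤ 1) (hs : HasSum (fun n => z n ^ 2) 1)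
    {p : ℕ} (hp : z p ≠ 0) :
    ∃ c > 0, ∃ N₀ > p, ∀ N ≥ N₀, ∀ K : Finset ℕ, (K : Set ℕ).OrdConnected → p ∈ K →
      (∀ n ∈ K, n ≠ p → z n = 0) ∨
        |∑ k ∈ K with k < N, z k| ≤ ∑ k ∈ K with k < N, |z k| - 2 * c := by
  classical
  -- `N₀` lies beyond the next nonzero coordinate after `p`, if there is one.
  obtain ⟨N₀, hpN, hN₀⟩ : ∃ N₀ > p, ∀ n, p < n → z n ≠ 0 →
      ∃ q, p < q ∧ q ≤ n ∧ q < N₀ ∧ z q ≠ 0 ∧ ∀ k, p < k → k < q → z k = 0 := by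
    by_cases h : ∃ n, p < n ∧ z n ≠ 0
    · refine ⟨Nat.find h + 1, by have := (Nat.find_spec h).1; omega, fun n hn hzn =>
        ⟨Nat.find h, (Nat.find_spec h).1, Nat.find_min' h ⟨hn, hzn⟩, Nat.lt_succ_self _,
          (Nat.find_spec h).2, fun k hk hk' => ?_⟩⟩
      by_contra hzk
      exact Nat.find_min h hk' ⟨hk, hzk⟩
    · exact ⟨p + 1, by omega, fun n hn hzn => absurd ⟨n, hn, hzn⟩ h⟩
  -- The smallest nonzero modulus below `N₀` bounds the cancellation: for opposite signs, `|z_p +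
  -- z_q| = |z_p| + |z_q| - 2 min(|z_p|, |z_q|)`.
  obtain ⟨r, hr, hrmin⟩ := Finset.exists_min_image ((Finset.range N₀).filter fun n => z n ≠ 0)
    (fun n => |z n|) ⟨p, by simp [hpN, hp]⟩
  simp only [Finset.mem_filter, Finset.mem_range] at hr hrmin
  refine ⟨|z r|, abs_pos.mpr hr.2, N₀, hpN, fun N hN K hK hpK => ?_⟩
  by_cases h : ∀ n ∈ K, n ≠ p → z n = 0
  · exact Or.inl h
  refine Or.inr ?_
  push Not at h
  obtain ⟨n, hnK, hnp, hzn⟩ := h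
  obtain ⟨q, hqK, hqp, hqN, hzq, hmul⟩ : ∃ q ∈ K, q ≠ p ∧ q < N₀ ∧ z q ≠ 0 ∧ z p * z q ≤ 0 := by
    rcases lt_or_gt_of_ne hnp with hlt | hgt
    · have hspec := Nat.findGreatest_spec (P := fun k => k < p ∧ z k ≠ 0) hlt.le ⟨hlt, hzn⟩
      have hle := Nat.le_findGreatest (P := fun k => k < p ∧ z k ≠ 0) hlt.le ⟨hlt, hzn⟩
      have hmax : ∀ k, Nat.findGreatest (fun k => k < p ∧ z k ≠ 0) p < k → k < p → z k = 0 := by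
        intro k hk hkp
        by_contra hzk
        exact Nat.findGreatest_is_greatest hk hkp.le ⟨hkp, hzk⟩
      refine ⟨_, hK.out hnK hpK ⟨hle, hspec.1.le⟩, hspec.1.ne, hspec.1.trans hpN, hspec.2, ?_⟩
      rw [mul_comm]
      exact mul_nonpos_of_consecutive hz hs hspec.1 hmax
    · obtain ⟨q, h1, h2, h3, h4, h5⟩ := hN₀ n hgt hzn
      exact ⟨q, hK.out hpK hnK ⟨h1.le, h2⟩, h1.ne', h3, h4, mul_nonpos_of_consecutive hz hs h1 h5⟩
  have hsub : ({p, q} : Finset ℕ) ⊆ K.filter (· < N) := by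
    intro k hk
    simp only [Finset.mem_insert, Finset.mem_singleton] at hk
    rcases hk with rfl | rfl
    · exact Finset.mem_filter.mpr ⟨hpK, by omega⟩
    · exact Finset.mem_filter.mpr ⟨hqK, by omega⟩
  rw [← Finset.sum_sdiff hsub, ← Finset.sum_sdiff hsub, Finset.sum_pair hqp.symm,
    Finset.sum_pair hqp.symm]
  have h1 : |z p + z q| ≤ |z p| + |z q| - 2 * |z r| := by
    have hp' := hrmin p ⟨hpN, hp⟩
    have hq' := hrmin q ⟨hqN, hzq⟩
    rcases abs_cases (z p) with ⟨e1, s1⟩ | ⟨e1, s1⟩ <;>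
      rcases abs_cases (z q) with ⟨e2, s2⟩ | ⟨e2, s2⟩ <;>
      rw [e1, e2] <;> rw [e1] at hp' <;> rw [e2] at hq'
    · exact absurd hmul (not_le.mpr (mul_pos (s1.lt_of_ne' hp) (s2.lt_of_ne' hzq)))
    · rw [abs_le]; constructor <;> linarith
    · rw [abs_le]; constructor <;> linarith
    · exact absurd hmul (not_le.mpr (mul_pos_of_neg_of_neg s1 s2))
  refine (abs_add_le _ _).trans ?_
  have h2 : |∑ k ∈ K.filter (· < N) \ {p, q}, z k| ≤ ∑ k ∈ K.filter (· < N) \ {p, q}, |z k| :=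
    Finset.abs_sum_le_sum_abs _ _
  linarith

/-- Perturbing at `p ∈ K` changes the two sides by `ε ∑ z` and `ε z_p`, which differ by at most
`2|ε| ≤ 2c`. Cancellation absorbs this, unless `z` vanishes on `K` off `p`, and then both changes
agree. -/
theorem excess_ofRange_add_single_le {z : JamesSpace} (hz : ‖z‖ ≤ 1) {σ : ℕ → ℝ}
    (hσ : Alternating σ) (hzσ : ∀ n, z n * σ n = |z n|) {p N : ℕ} {c ε : ℝ} (hpN : p < N)
    (hε : |ε| ≤ c) (hc : ∀ K : Finset ℕ, (K : Set ℕ).OrdConnected → p ∈ K →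
      (∀ n ∈ K, n ≠ p → z n = 0) ∨
        |∑ k ∈ K with k < N, z k| ≤ ∑ k ∈ K with k < N, |z k| - 2 * c)
    (K : Finset ℕ) (hK : (K : Set ℕ).OrdConnected) :
    (∑ k ∈ K, z k) * ∑ k ∈ K, (ofRange σ N + ε • single p : JamesSpace) k ≤
      ∑ k ∈ K, z k * (ofRange σ N + ε • single p : JamesSpace) k +
        if N ∈ K then ‖high N z‖ else 0 := by
  have h0 := excess_ofRange_le hσ hzσ N K hK
  have e1 : ∑ k ∈ K, (ofRange σ N + ε • single p : JamesSpace) k =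
      ∑ k ∈ K, ofRange σ N k + if p ∈ K then ε else 0 := by
    simp only [coe_add, coe_smul, Pi.add_apply, Pi.smul_apply, single_apply, smul_eq_mul, mul_ite,
      mul_one, mul_zero, Finset.sum_add_distrib, Finset.sum_ite_eq']
  have e2 : ∑ k ∈ K, z k * (ofRange σ N + ε • single p : JamesSpace) k =
      ∑ k ∈ K, z k * ofRange σ N k + if p ∈ K then ε * z p else 0 := by
    simp only [coe_add, coe_smul, Pi.add_apply, Pi.smul_apply, single_apply, smul_eq_mul, mul_ite,
      mul_one, mul_zero, mul_add, Finset.sum_add_distrib, Finset.sum_ite_eq']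
    simp only [mul_comm]
  rw [e1, e2]
  by_cases hp : p ∈ K
  swap
  · simpa [hp] using h0
  rw [if_pos hp, if_pos hp]
  rcases hc K hK hp with h | h
  · rw [show ∑ k ∈ K, z k = z p from Finset.sum_eq_single_of_mem p hp h] at h0 ⊢
    linarith
  · rw [sum_ofRange, sum_mul_ofRange hzσ] at *
    have h1 := abs_sum_ge_le z N hK ⟨p, hp, hpN⟩
    have h2 := hσ.abs_sum_le (ordConnected_filter hK _ (ordConnected_lt N))
    have h3 : ε * (∑ k ∈ K, z k - z p) ≤ 2 * c := by
      have h4 := abs_le.mp ((z.abs_sum_le_norm K hK).trans hz)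
      have h5 := abs_le.mp ((z.abs_apply_le_norm p).trans hz)
      refine (le_abs_self _).trans ?_
      rw [abs_mul]
      have h6 : |∑ k ∈ K, z k - z p| ≤ 2 := abs_le.mpr ⟨by linarith, by linarith⟩
      nlinarith [abs_nonneg ε, abs_nonneg (∑ k ∈ K, z k - z p)]
    have h7 : (∑ k ∈ K, z k) * ∑ k ∈ K with k < N, σ k ≤
        ∑ k ∈ K with k < N, |z k| - 2 * c + if N ∈ K then ‖high N z‖ else 0 := by
      rw [← Finset.sum_filter_add_sum_filter_not K (· < N) fun k => z k]
      refine (le_abs_self _).trans ?_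
      rw [abs_mul]
      refine (mul_le_of_le_one_right (abs_nonneg _) h2).trans ?_
      exact (abs_add_le _ _).trans (add_le_add h h1)
    linarith

theorem coe_sign_eq_zero (r : ℝ) : ((SignType.sign r : SignType) : ℝ) = 0 ↔ r = 0 := by
  rcases lt_trichotomy r 0 with h | h | h
  · simp [h, h.ne]
  · simp [h]
  · simp [h, h.ne']

/-- The signs of a unit vector of `ℓ²` in the unit ball of `J` alternate. -/
theorem alternating_sign {z : JamesSpace} (hz : ‖z‖ ≤ 1) (hs : HasSum (fun n => z n ^ 2) 1) :
    Alternating fun n => SignType.sign (z n) := by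
  constructor
  · intro n
    rcases lt_trichotomy (z n) 0 with h | h | h <;> simp [h]
  · intro a b hab ha hb h0
    have ha' : z a ≠ 0 := fun h => ha (by simp [h])
    have hb' : z b ≠ 0 := fun h => hb (by simp [h])
    have hmul := mul_nonpos_of_consecutive hz hs hab fun n h1 h2 => (coe_sign_eq_zero _).mp (h0 n h1 h2)
    rcases lt_or_gt_of_ne ha' with h | h <;> rcases lt_or_gt_of_ne hb' with h' | h'
    · exact absurd hmul (not_le.mpr (mul_pos_of_neg_of_neg h h'))
    · simp [h, h']
    · simp [h, h']
    · exact absurd hmul (not_le.mpr (mul_pos h h'))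

/-- Beyond the nonzero terms of an alternating sequence one more term can be added. -/
theorem Alternating.exists_add_single {σ : ℕ → ℝ} (hσ : Alternating σ) {q p : ℕ} (hq : σ q ≠ 0)
    (hp : (∀ n, σ n ≠ 0 → p < n) ∨ ∀ n, σ n ≠ 0 → n < p) :
    ∃ τ : ℝ, τ ≠ 0 ∧ Alternating fun n => σ n + if n = p then τ else 0 := by
  classical
  have hp0 : σ p = 0 := by
    by_contra h
    rcases hp with hp | hp <;> exact absurd (hp p h) (lt_irrefl p)
  -- the nonzero term next to `p`
  obtain ⟨l, hl, hl1, hl2⟩ : ∃ l, σ l ≠ 0 ∧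
      (∀ b, p < b → σ b ≠ 0 → (∀ n, p < n → n < b → σ n = 0) → b = l) ∧
      (∀ a, a < p → σ a ≠ 0 → (∀ n, a < n → n < p → σ n = 0) → a = l) := by
    rcases hp with hp | hp
    · have hex : ∃ n, σ n ≠ 0 := ⟨q, hq⟩
      refine ⟨Nat.find hex, Nat.find_spec hex, fun b hb hσb h => ?_, fun a ha hσa =>
        absurd (hp a hσa) (by omega)⟩
      have h1 := Nat.find_min' hex hσb
      by_contra hne
      exact Nat.find_spec hex (h _ (hp _ (Nat.find_spec hex)) (by omega))
    · have hspec := Nat.findGreatest_spec (P := fun k => σ k ≠ 0) (hp q hq).le hq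
      refine ⟨Nat.findGreatest (fun k => σ k ≠ 0) p, hspec, fun b hb hσb =>
        absurd (hp b hσb) (by omega), fun a ha hσa h => ?_⟩
      have h1 := Nat.le_findGreatest (P := fun k => σ k ≠ 0) ha.le hσa
      by_contra hne
      exact hspec (h _ (by omega) (hp _ hspec))
  refine ⟨-σ l, neg_ne_zero.mpr hl, fun n => ?_, fun a b hab ha hb h0 => ?_⟩
  · by_cases hn : n = p
    · subst hn
      right
      simpa [hp0] using (hσ.1 l).resolve_left hl
    · simpa [hn] using hσ.1 n
  · have hne : ∀ n, n ≠ p → (σ n + if n = p then -σ l else 0) = σ n := fun n hn => by simp [hn]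
    beta_reduce at ha hb h0 ⊢
    by_cases hap : a = p
    · subst hap
      rw [hne b hab.ne'] at hb ⊢
      have := hl1 b hab hb fun n h1 h2 => by rw [← hne n h1.ne', h0 n h1 h2]
      subst this
      simp [hp0]
    · by_cases hbp : b = p
      · subst hbp
        rw [hne a hap] at ha ⊢
        have := hl2 a hab ha fun n h1 h2 => by rw [← hne n h2.ne, h0 n h1 h2]
        subst this
        simp [hp0]
      · rw [hne a hap] at ha ⊢
        rw [hne b hbp] at hb ⊢
        refine hσ.2 a b hab ha hb fun n h1 h2 => ?_
        by_cases hn : n = p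
        · rw [hn, hp0]
        · rw [← hne n hn, h0 n h1 h2]

/-! ### Components of a convex combination agree on unit vectors -/

theorem apply_eq_sum_of_finite (f : StrongDual ℝ JamesSpace) (y : JamesSpace) {N : ℕ}
    (hy : ∀ n, N ≤ n → y n = 0) : f y = ∑ n ∈ Finset.range N, y n * f (single n) := by
  have h : low N y = y := ext fun n => by
    rw [low_apply]
    split_ifs with hn
    · rfl
    · exact (hy n (not_lt.mp hn)).symm
  conv_lhs => rw [← h, low_eq_sum]
  simp

/-- A convex combination of two functionals in the unit ball which attains its norm at `z` is close
to both functionals on vectors with small excess. -/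
theorem abs_apply_sub_le {z y : JamesSpace} (hz : ‖z‖ ≤ 1) (hs : HasSum (fun n => z n ^ 2) 1)
    {f g h : StrongDual ℝ JamesSpace} (hg : ‖g‖ ≤ 1) (hh : ‖h‖ ≤ 1) {a b : ℝ} (ha : 0 < a)
    (hb : 0 < b) (hab : a + b = 1) (hf : a • g + b • h = f) (hfz : f z = 1)
    (hzy : ∀ n, 0 ≤ z n * y n) (hfy : ∀ n, y n * f (single n) = z n * y n) {M : ℕ}
    (hy : ∀ n, M ≤ n → y n = 0) {η : ℝ} (hη : 0 ≤ η) (N : ℕ)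
    (hK : ∀ K : Finset ℕ, (K : Set ℕ).OrdConnected →
      (∑ k ∈ K, z k) * ∑ k ∈ K, y k ≤ ∑ k ∈ K, z k * y k + if N ∈ K then η else 0) :
    |g y - f y| ≤ a⁻¹ * η := by
  have hS : HasSum (fun n => z n * y n) (f y) := by
    rw [apply_eq_sum_of_finite f y hy, Finset.sum_congr rfl fun n _ => hfy n]
    refine hasSum_sum_of_ne_finset_zero fun n hn => ?_
    rw [hy n (by simpa using hn), mul_zero]
  have hle : ∀ k : StrongDual ℝ JamesSpace, ‖k‖ ≤ 1 → k z ≤ 1 := fun k hk => by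
    have h1 := k.le_of_opNorm_le hk z
    rw [Real.norm_eq_abs] at h1
    linarith [le_abs_self (k z)]
  have hfz' : a * g z + b * h z = 1 := by
    rw [← hfz, ← hf]
    simp
  have hfy' : a * g y + b * h y = f y := by
    rw [← hf]
    simp
  -- A strict convex average of two numbers at most one equals one only if both do.
  have hgz : g z = 1 := by nlinarith [hle g hg, hle h hh]
  have hhz : h z = 1 := by nlinarith [hle g hg, hle h hh]
  have h1 := apply_le_of_excess_le hz hs hzy hS hη N hK hg hgz
  have h2 := apply_le_of_excess_le hz hs hzy hS hη N hK hh hhz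
  have ha1 : 1 ≤ a⁻¹ := (one_le_inv₀ ha).mpr (by linarith)
  have h3 : a * (a⁻¹ * η) = η := by rw [← mul_assoc, mul_inv_cancel₀ ha.ne', one_mul]
  rw [abs_le]
  constructor
  -- The lower bound for `g` comes from the upper bound for `h`; passing through the convex
  -- combination costs the factor `b / a ≤ a⁻¹`.
  · have h4 : b * (h y - f y) ≤ b * η := mul_le_mul_of_nonneg_left (by linarith) hb.le
    have h5 : a * (g y - f y) + b * (h y - f y) = 0 := by
      linear_combination hfy' - f y * hab
    have h6 : a * -(a⁻¹ * η) ≤ a * (g y - f y) := by nlinarith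
    exact le_of_mul_le_mul_left h6 ha
  · nlinarith

/-- Compare `f` and `g` on the first `N` signs of `z` with and without `ε e_p`; both errors vanish
as `N` grows. At a nonzero coordinate, cancellation makes room for the perturbation. At a point
outside the hull of the support, one more alternating sign fits, while `z` itself is unchanged;
between two support points of opposite sign this would fail. -/
theorem apply_single_eq {z : JamesSpace} (hz : ‖z‖ ≤ 1) (hs : HasSum (fun n => z n ^ 2) 1)
    {f g h : StrongDual ℝ JamesSpace} (hg : ‖g‖ ≤ 1) (hh : ‖h‖ ≤ 1) {a b : ℝ} (ha : 0 < a)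
    (hb : 0 < b) (hab : a + b = 1) (hf : a • g + b • h = f) (hfz : f z = 1)
    (hfn : ∀ n, z n ≠ 0 → f (single n) = z n) {p : ℕ}
    (hp : z p ≠ 0 ∨ f (single p) = 0 ∧ ((∀ n, z n ≠ 0 → p < n) ∨ ∀ n, z n ≠ 0 → n < p)) :
    g (single p) = f (single p) := by
  set σ : ℕ → ℝ := fun n => SignType.sign (z n) with hσdef
  have hσ : Alternating σ := alternating_sign hz hs
  have hzσ : ∀ n, z n * σ n = |z n| := fun n => by rw [mul_comm]; exact sign_mul_self (z n)
  have hσ0 : ∀ n, σ n ≠ 0 ↔ z n ≠ 0 := fun n => (coe_sign_eq_zero _).not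
  -- it suffices to compare the two functionals on a perturbation of the signs
  suffices H : ∃ ε : ℝ, ε ≠ 0 ∧ ∃ N₀ : ℕ, ∀ N ≥ N₀, p < N ∧
      (∀ n, 0 ≤ z n * (ofRange σ N + ε • single p : JamesSpace) n) ∧
      ∀ K : Finset ℕ, (K : Set ℕ).OrdConnected →
        (∑ k ∈ K, z k) * ∑ k ∈ K, (ofRange σ N + ε • single p : JamesSpace) k ≤
          ∑ k ∈ K, z k * (ofRange σ N + ε • single p : JamesSpace) k +
            if N ∈ K then ‖high N z‖ else 0 by
    obtain ⟨ε, hε, N₀, H⟩ := H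
    have hfz0 : ∀ n, σ n * f (single n) = z n * σ n := fun n => by
      by_cases hn : z n = 0
      · have : σ n = 0 := by simp [σ, hn]
        simp [this]
      · rw [hfn n hn, mul_comm]
    have hfp : f (single p) = z p := by
      by_cases hzp : z p = 0
      · rw [hzp]
        exact (hp.resolve_left fun h => h hzp).1
      · exact hfn p hzp
    have hbound : ∀ N ≥ N₀, |ε * (g (single p) - f (single p))| ≤ 2 * (a⁻¹ * ‖high N z‖) := by
      intro N hN
      obtain ⟨hpN, hpos, hex⟩ := H N hN
      have h1 := abs_apply_sub_le (y := ofRange σ N) hz hs hg hh ha hb hab hf hfz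
        (fun n => by
          rw [ofRange_apply]
          split_ifs
          · rw [hzσ]; exact abs_nonneg _
          · simp)
        (fun n => by
          rw [ofRange_apply]
          split_ifs
          · exact hfz0 n
          · simp)
        (M := N) (fun n hn => by rw [ofRange_apply, if_neg (by omega)]) (norm_nonneg _) N
        (excess_ofRange_le hσ hzσ N)
      have h2 := abs_apply_sub_le (y := ofRange σ N + ε • single p) hz hs hg hh ha hb hab hf hfz
        hpos
        (fun n => by
          rw [coe_add, coe_smul, Pi.add_apply, Pi.smul_apply, ofRange_apply, single_apply,
            smul_eq_mul, add_mul, mul_add]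
          congr 1
          · split_ifs
            · exact hfz0 n
            · simp
          · split_ifs with hn
            · rw [hn, hfp]; ring
            · simp)
        (M := N) (fun n hn => by
          rw [coe_add, coe_smul, Pi.add_apply, Pi.smul_apply, ofRange_apply, single_apply,
            if_neg (by omega), if_neg (by omega)]
          simp) (norm_nonneg _) N hex
      have e : ε * (g (single p) - f (single p)) =
          (g (ofRange σ N + ε • single p) - f (ofRange σ N + ε • single p)) -
            (g (ofRange σ N) - f (ofRange σ N)) := by
        simp only [map_add, map_smul, smul_eq_mul]
        ring
      rw [e]
      refine (abs_sub _ _).trans ?_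
      linarith
    have hlim : Tendsto (fun N => 2 * (a⁻¹ * ‖high N z‖)) atTop (𝓝 0) := by
      simpa using (z.tendsto_norm_high.const_mul a⁻¹).const_mul 2
    have h0 := ge_of_tendsto hlim ((eventually_ge_atTop N₀).mono hbound)
    have h1 := abs_eq_zero.mp (le_antisymm h0 (abs_nonneg _))
    exact sub_eq_zero.mp ((mul_eq_zero.mp h1).resolve_left hε)
  rcases hp with hp | ⟨-, hp⟩
  · obtain ⟨c, hc, N₀, hpN₀, hcan⟩ := exists_cancellation hz hs hp
    refine ⟨min c 1, (lt_min hc one_pos).ne', N₀, fun N hN => ?_⟩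
    have hpN : p < N := by omega
    refine ⟨hpN, fun n => ?_, fun K hK => ?_⟩
    · have hε0 : 0 < min c 1 := lt_min hc one_pos
      rw [coe_add, coe_smul, Pi.add_apply, Pi.smul_apply, ofRange_apply, single_apply,
        smul_eq_mul, mul_add]
      by_cases hn : n = p
      · rw [hn, if_pos hpN, if_pos rfl, hzσ, mul_one]
        have h1 : |z p * min c 1| ≤ |z p| := by
          rw [abs_mul, abs_of_pos hε0]
          exact mul_le_of_le_one_right (abs_nonneg _) (min_le_right _ _)
        linarith [neg_abs_le (z p * min c 1)]
      · rw [if_neg hn, mul_zero, mul_zero, add_zero]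
        split_ifs
        · rw [hzσ]
          exact abs_nonneg _
        · rw [mul_zero]
    · refine excess_ofRange_add_single_le hz hσ hzσ hpN (c := c) ?_ (hcan N hN) K hK
      rw [abs_of_pos (lt_min hc one_pos)]
      exact min_le_left _ _
  · obtain ⟨q, hq⟩ : ∃ q, z q ≠ 0 := by
      by_contra! hq
      have h0 : HasSum (fun n => z n ^ 2) 0 := by
        convert hasSum_zero using 2 with n
        simp [hq]
      exact one_ne_zero (hs.unique h0)
    obtain ⟨τ, hτ, hτσ⟩ := hσ.exists_add_single ((hσ0 q).mpr hq) (p := p) (by simpa [hσ0] using hp)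
    have hzp : z p = 0 := by
      by_contra h
      rcases hp with hp | hp <;> exact absurd (hp p h) (lt_irrefl p)
    refine ⟨τ, hτ, p + 1, fun N hN => ⟨by omega, ?_⟩⟩
    have e : ofRange σ N + τ • single p = ofRange (fun n => σ n + if n = p then τ else 0) N := by
      refine ext fun n => ?_
      rw [coe_add, coe_smul, Pi.add_apply, Pi.smul_apply, ofRange_apply, ofRange_apply,
        single_apply]
      by_cases hn : n = p
      · have : n < N := by omega
        simp [hn, hn ▸ this]
      · simp [hn]
    have hz' : ∀ n, z n * (σ n + if n = p then τ else 0) = |z n| := fun n => by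
      rw [← hzσ n]
      by_cases hn : n = p
      · simp [hn, hzp]
      · simp [hn]
    rw [e]
    refine ⟨fun n => ?_, excess_ofRange_le hτσ hz' N⟩
    rw [ofRange_apply]
    by_cases hn : n < N
    · rw [if_pos hn, hz']
      exact abs_nonneg _
    · rw [if_neg hn, mul_zero]

end JamesSpace

/-! ### Sufficiency and the theorem -/

/-- A vector of `J` with the coordinates `x i` at points `m i` in increasing order. -/
theorem JamesSpace.exists_spread (x : JamesSpace) {F : Set ℕ} (hF : ∀ i ∈ F, ∀ k ≤ i, k ∈ F)
    {m : F → ℕ} (hm : StrictMono m) :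
    ∃ z : JamesSpace, ‖z‖ ≤ ‖x‖ ∧ (∀ i, z (m i) = x i) ∧ ∀ n, n ∉ Set.range m → z n = 0 := by
  classical
  have hfin : ∀ K : Finset ℕ, {i | ∃ h : i ∈ F, m ⟨i, h⟩ ∈ K}.Finite := by
    intro K
    refine (Set.Finite.preimage hm.injective.injOn K.finite_toSet).image Subtype.val |>.subset ?_
    rintro i ⟨h, hi⟩
    exact ⟨⟨i, h⟩, hi, rfl⟩
  let ζ : ℕ → ℝ := fun n => if h : ∃ i, m i = n then x h.choose else 0
  have hζ : ∀ i, ζ (m i) = x i := by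
    intro i
    have h : ∃ k, m k = m i := ⟨i, rfl⟩
    simp only [ζ, dif_pos h]
    rw [hm.injective h.choose_spec]
  have hζ0 : ∀ n, n ∉ Set.range m → ζ n = 0 := fun n hn => dif_neg hn
  obtain ⟨z, hz, hz1⟩ := x.exists_norm_le ζ (fun K => (hfin K).toFinset)
    (fun K hK => by
      rw [Set.Finite.coe_toFinset]
      refine ⟨?_⟩
      rintro a ⟨ha, haK⟩ b ⟨hb, hbK⟩ c hc
      have hcF := hF b hb c hc.2
      exact ⟨hcF, hK.out haK hbK ⟨hm.monotone (Subtype.mk_le_mk.mpr hc.1),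
        hm.monotone (Subtype.mk_le_mk.mpr hc.2)⟩⟩)
    (fun K L _ _ hKL => by
      rw [Finset.disjoint_left]
      intro i hi hi'
      rw [Set.Finite.mem_toFinset] at hi hi'
      obtain ⟨_, hiK⟩ := hi
      obtain ⟨_, hiL⟩ := hi'
      exact Finset.disjoint_left.mp hKL hiK hiL)
    (fun K _ => by
      symm
      refine Finset.sum_of_injOn (fun i => if h : i ∈ F then m ⟨i, h⟩ else 0) ?_ ?_ ?_ ?_
      · intro i hi k hk hik
        obtain ⟨hiF, -⟩ := (Set.Finite.mem_toFinset _).mp hi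
        obtain ⟨hkF, -⟩ := (Set.Finite.mem_toFinset _).mp hk
        simp only [dif_pos hiF, dif_pos hkF] at hik
        exact congrArg Subtype.val (hm.injective hik)
      · intro i hi
        obtain ⟨hiF, hiK⟩ := (Set.Finite.mem_toFinset _).mp hi
        simpa only [dif_pos hiF, Finset.mem_coe] using hiK
      · intro n hn hn'
        refine hζ0 n ?_
        rintro ⟨i, rfl⟩
        refine hn' ⟨i, ?_, by simp⟩
        exact (Set.Finite.mem_toFinset _).mpr ⟨i.2, hn⟩
      · intro i hi
        obtain ⟨hiF, -⟩ := (Set.Finite.mem_toFinset _).mp hi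
        rw [dif_pos hiF, hζ])
  exact ⟨z, hz1, fun i => by rw [hz, hζ], fun n hn => by rw [hz, hζ0 n hn]⟩

theorem IsIndexSet.mem_of_le {F : Set ℕ} (hF : IsIndexSet F) : ∀ i ∈ F, ∀ k ≤ i, k ∈ F := by
  rcases hF with rfl | ⟨n, -, rfl⟩
  · exact fun _ _ _ _ => trivial
  · exact fun i hi k hk => lt_of_le_of_lt hk hi

/-- For every `p` a norming vector `z` adapted to `p` is built, and `apply_single_eq` then
identifies the components of any convex combination at `e_p`. -/
theorem mem_extremePoints_of_representation {xs : StrongDual ℝ JamesSpace} {F : Set ℕ}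
    {α : F → ℝ} {I : F → NatInterval} (hF : IsIndexSet F) (hI : Successive I)
    (hα : ∀ i, α i ≠ 0) (hsum : HasSum (fun i => α i • (I i).functional) xs)
    {x : JamesSpace} (hxα : ∀ i : F, x i = α i) (hx0 : ∀ n, n ∉ F → x n = 0)
    (hx : x ∈ Set.extremePoints ℝ (Metric.closedBall (0 : JamesSpace) 1))
    (hU : (⋃ i, (I i).carrier).OrdConnected) :
    xs ∈ Set.extremePoints ℝ (Metric.closedBall (0 : StrongDual ℝ JamesSpace) 1) := by
  classical
  have hx1 := norm_eq_one_of_mem_extremePoints hx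
  have hdis := hI.pairwise_disjoint
  have hsq : HasSum (fun i => α i ^ 2) 1 := by
    have h := (hasSum_subtype_iff_of_support_subset (f := fun n => x n ^ 2) (s := F)
      fun n hn => by
        by_contra hnF
        exact hn (by simp [hx0 n hnF])).mpr (hasSum_sq_of_mem_extremePoints hx)
    refine h.congr_fun fun i => ?_
    simp [hxα]
  have hxs1 : ‖xs‖ ≤ 1 := abs_le_of_sq_le_sq'
    (by simpa using NatInterval.norm_sq_le_of_hasSum hdis hsq hsum) zero_le_one |>.2
  refine mem_extremePoints_iff_left.mpr ⟨by simpa using hxs1, fun g hg h hh hxsgh => ?_⟩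
  obtain ⟨a, b, ha, hb, hab, hf⟩ := hxsgh
  rw [mem_closedBall_zero_iff] at hg hh
  refine dual_ext fun p => ?_
  -- One point is chosen in each interval, and it is `p` in the interval containing `p`, if any; so
  -- `z p ≠ 0` in that case.
  have hex : ∀ i, ∃ n ∈ (I i).carrier, p ∈ (I i).carrier → n = p := by
    intro i
    by_cases hp : p ∈ (I i).carrier
    · exact ⟨p, hp, fun _ => rfl⟩
    · obtain ⟨n, hn⟩ := (I i).nonempty
      exact ⟨n, hn, fun h => absurd h hp⟩
  choose m hmI hmp using hex
  have hm : StrictMono m := fun i k hik => hI i k hik _ (hmI i) _ (hmI k)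
  obtain ⟨z, hzx, hzm, hz0⟩ := x.exists_spread hF.mem_of_le hm
  have hz1 : ‖z‖ ≤ 1 := hzx.trans hx1.le
  have hzα : ∀ i, z (m i) = α i := fun i => (hzm i).trans (hxα i)
  have hzsq : HasSum (fun n => z n ^ 2) 1 := by
    refine (hm.injective.hasSum_iff fun n hn => ?_).mp ?_
    · simp [hz0 n hn]
    · refine hsq.congr_fun fun i => ?_
      simp [hzα]
  have hrange : ∀ n, z n ≠ 0 → ∃ i, m i = n := fun n hn => by
    by_contra h
    exact hn (hz0 n h)
  have hfz : xs z = 1 := by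
    have h1 := (ContinuousLinearMap.apply ℝ ℝ z).hasSum hsum
    refine h1.unique (hsq.congr_fun fun i => ?_)
    have h2 : (I i).functional z = α i := by
      rw [(I i).functional_eq_of_unique z (m i) (hmI i) fun n hn hne => ?_, hzα]
      refine hz0 n ?_
      rintro ⟨k, rfl⟩
      have hki : k ≠ i := fun h => hne (by rw [h])
      exact Set.disjoint_left.mp (hdis hki) (hmI k) hn
    simp [h2, sq]
  refine apply_single_eq hz1 hzsq hg hh ha hb hab hf hfz (fun n hn => ?_) ?_
  · obtain ⟨i, rfl⟩ := hrange n hn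
    rw [NatInterval.hasSum_apply_single_of_mem hdis hsum (hmI i), hzα]
  · by_cases hp : ∃ i, p ∈ (I i).carrier
    · obtain ⟨i, hi⟩ := hp
      left
      rw [← hmp i hi, hzα]
      exact hα i
    · right
      have hp' : p ∉ ⋃ i, (I i).carrier := by simpa using hp
      push Not at hp
      refine ⟨NatInterval.hasSum_apply_single_of_notMem hsum hp, ?_⟩
      -- Support points of `z` on both sides of `p` would put `p` into the union of the intervals,
      -- since that union is an interval.
      by_contra! hcon
      obtain ⟨⟨u, hu, hup⟩, ⟨v, hv, hpv⟩⟩ := hcon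
      obtain ⟨i, rfl⟩ := hrange u hu
      obtain ⟨k, rfl⟩ := hrange v hv
      exact hp' (hU.out (Set.mem_iUnion.mpr ⟨i, hmI i⟩) (Set.mem_iUnion.mpr ⟨k, hmI k⟩) ⟨hup, hpv⟩)

theorem mainTheorem7 (xs : StrongDual ℝ JamesSpace) :
    xs ∈ Set.extremePoints ℝ (Metric.closedBall (0 : StrongDual ℝ JamesSpace) 1) ↔
      ∃ (F : Set ℕ) (α : F → ℝ) (I : F → NatInterval),
        IsIndexSet F ∧ Successive I ∧ (∀ i, α i ≠ 0) ∧
        HasSum (fun i => α i • (I i).functional) xs ∧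
        (∃ x : JamesSpace, (∀ i : F, x i = α i) ∧ (∀ n, n ∉ F → x n = 0) ∧
          x ∈ Set.extremePoints ℝ (Metric.closedBall (0 : JamesSpace) 1)) ∧
        (⋃ i, (I i).carrier).OrdConnected := by
  constructor
  · exact exists_representation_of_mem_extremePoints
  · rintro ⟨F, α, I, hF, hI, hα, hsum, ⟨x, hxα, hx0, hx⟩, hU⟩
    exact mem_extremePoints_of_representation hF hI hα hsum hxα hx0 hx hU
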